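/- **Conventions.** For tempered distributions on $\mathbb R^3$ the Fourier transform is normalized by $f(x)=\int_{\mathbb R^3}e^{ix\cdot\xi}\widehat f(\xi)\,d\xi$, so that $\widehat{fg}=\widehat f*\widehat g$ and $\widehat{\partial_jf}=i\xi_j\widehat f$. For $i\in\{-1,0,1\}$ let $\chi^i$ be the space of $f\in\mathcal S'(\mathbb R^3)$ (vector-valued, with the Euclidean norm on $\mathbb C^3$) whose Fourier transform is a locally integrable function with $\|f\|_{\chi^i}=\int_{\mathbb R^3}|\xi|^i|\widehat f(\xi)|\,d\xi<\infty$. Let $\mathcal P$ be the Leray projection, $\widehat{(\mathcal Pf)^j}(\xi)=\widehat{f^j}(\xi)-|\xi|^{-2}\sum_{k}\xi_j\xi_k\widehat{f^k}(\xi)$. For $\nu>0$ consider the incompressible Navier–Stokes system $$(NS_\nu)\qquad \partial_tu-\nu\Delta u=\mathcal P\nabla\cdot(u\otimes u),\qquad \operatorname{div}u=0,\qquad u|_{t=0}=u_0,\qquad t>0,\ x\in\mathbb R^3,$$ (the substitution $u\mapsto-u$ gives the opposite sign on the right). A solution in $L^2([0,T];\chi^0)$ is a $u\in L^2([0,T];\chi^0)$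 with $\operatorname{div}u(t)=0$ for a.e. $t$ that satisfies the mild formulation: for a.e. $t\in[0,T]$ and a.e. $\xi$, $$\widehat u(t,\xi)=e^{-\nu t|\xi|^2}\widehat{u_0}(\xi)+\int_0^te^{-\nu(t-s)|\xi|^2}\,\mathcal F\big(\mathcal P\nabla\cdot(u\otimes u)\big)(s,\xi)\,ds .$$ **Theorem.** Let $\nu>0$ and let $u_0\in\chi^{-1}$ be divergence free. There exists $T>0$ such that $(NS_\nu)$ has a unique solution $u$ in $L^2([0,T];\chi^0)$, and (after modification on a null set of times) $u(0)=u_0$ and $$u\in C([0,T];\chi^{-1})\cap L^1([0,T];\chi^1)\cap L^\infty([0,T];\chi^{-1}).$$ Let $T_{u_0}\in(0,\infty]$ be the supremum of all $T>0$ for which a solution in $L^2([0,T];\chi^0)$ exists. There is a $u$ on $[0,T_{u_0})$ with $u(0)=u_0$ that is, for every $0<T<T_{u_0}$, a solution in $L^2([0,T];\chi^0)$ and belongs to the above intersection; for every $T>0$, every solution in $L^2([0,T];\chi^0)$ coincides with $u$ for a.e. $t\in[0,T]$. If $u_0$ is real-valued, so is $u(t)$ for all $t\in[0,T_{u_0})$.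 Moreover: (i) If $\|u_0\|_{\chi^{-1}}<\nu$, then $T_{u_0}=\infty$, and for all $t\ge0$ $$\|u(t)\|_{\chi^{-1}}+\big(\nu-\|u_0\|_{\chi^{-1}}\big)\int_0^t\|u(s)\|_{\chi^1}\,ds\le\|u_0\|_{\chi^{-1}}.$$ (ii) If $T_{u_0}<\infty$, then $\displaystyle\int_0^{T_{u_0}}\|u(t)\|_{\chi^0}^2\,dt=\infty.$ -/

import Mathlib

open MeasureTheory Set Filter Topology
open scoped SchwartzMap FourierTransform LineDeriv ENNReal

noncomputable section

namespace ChiNS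

/-- Physical (and frequency) space `ℝ³` with the Euclidean norm. -/
abbrev R3 : Type := EuclideanSpace ℝ (Fin 3)

/-- `ℂ³` with the Hermitian norm. -/
abbrev C3 : Type := EuclideanSpace ℂ (Fin 3)

/-- Vector-valued tempered distributions on `ℝ³`. -/
abbrev Field3 : Type := 𝓢'(R3, C3)

/-- The Fourier transform of the tempered distribution `f` is the function `g`. Here
`𝓕 φ (ξ) = ∫ exp (-2πi x·ξ) φ(x) dx`, so that `∂ⱼ` becomes multiplication by `2πi ξⱼ` and the
transform of a product is the convolution of the transforms, without constants. -/
def HasFourierDensity (f : Field3) (g : R3 → C3) : Prop :=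
  ∀ φ : 𝓢(R3, ℂ), Integrable (fun ξ => φ ξ • g ξ) ∧ (𝓕 f) φ = ∫ ξ, φ ξ • g ξ

/-- The norm of `χ^s`: `∫ |2πξ|^s |f̂(ξ)| dξ` if the Fourier transform of `f` is a function, and `∞`
otherwise (infimum of the empty set; the density is unique up to a null set). In the frequency
variable `ζ = 2πξ`, with `f(x) = ∫ exp (i x·ζ) f̂(ζ) dζ`, this is `∫ |ζ|^s |f̂(ζ)| dζ`. -/
def chiNorm (s : ℤ) (f : Field3) : ℝ≥0∞ :=
  ⨅ (g : R3 → C3) (_ : HasFourierDensity f g),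
    ∫⁻ ξ, ENNReal.ofReal ((2 * Real.pi * ‖ξ‖) ^ s) * ‖g ξ‖ₑ

/-- Membership in `χ^s`. -/
def MemChi (s : ℤ) (f : Field3) : Prop := chiNorm s f < ⊤

/-- `div f = 0` in the sense of distributions. -/
def IsDivFree (f : Field3) : Prop :=
  ∀ φ : 𝓢(R3, ℂ), ∑ j : Fin 3, (∂_{EuclideanSpace.single j (1 : ℝ)} f) φ j = 0

/-- `f` is real-valued: it takes real values on real test functions. -/
def IsRealField (f : Field3) : Prop :=
  ∀ φ : 𝓢(R3, ℂ), (∀ x, (φ x).im = 0) → ∀ j, (f φ j).im = 0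

/-- `U` is a jointly measurable version, on the time set `I`, of the spatial Fourier transform
`(t, ξ) ↦ û(t, ξ)` of the time-dependent distribution `u`. -/
def HasSpaceTimeDensity (I : Set ℝ) (u : ℝ → Field3) (U : ℝ → R3 → C3) : Prop :=
  AEStronglyMeasurable (Function.uncurry U) ((volume.restrict I).prod volume) ∧
    ∀ᵐ t ∂(volume.restrict I), HasFourierDensity (u t) (U t)

/-- `u ∈ L^p([0,T]; χ^s)`. -/
def MemLpChi (p : ℝ≥0∞) (s : ℤ) (T : ℝ) (u : ℝ → Field3) : Prop :=
  (∃ U, HasSpaceTimeDensity (Icc 0 T) u U) ∧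
    eLpNorm (fun t => chiNorm s (u t)) p (volume.restrict (Icc 0 T)) < ⊤

/-- `u ∈ C([0,T]; χ^s)`. -/
def MemCChi (s : ℤ) (T : ℝ) (u : ℝ → Field3) : Prop :=
  ∀ t ∈ Icc 0 T, MemChi s (u t) ∧
    Tendsto (fun τ => chiNorm s (u τ - u t)) (𝓝[Icc 0 T] t) (𝓝 0)

/-- The symbol of the Leray projection:
`(𝒫 a)ⱼ = aⱼ - |ξ|⁻² ∑ₖ ξⱼ ξₖ aₖ`. -/
def leraySymbol (ξ : R3) (a : C3) : C3 :=
  WithLp.toLp 2 fun j => a j - (∑ k, (ξ j : ℂ) * (ξ k : ℂ) * a k) / ((‖ξ‖ ^ 2 : ℝ) : ℂ)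

/-- For `V = v̂`, the Fourier transform of `div (v ⊗ v)`, whose `l`-th component is
`∑ₖ ∂ₖ (vᵏ vˡ)`; the transform of `vᵏ vˡ` is `∫ v̂ᵏ(η) v̂ˡ(ξ - η) dη`. -/
def divTensorHat (V : R3 → C3) (ξ : R3) : C3 :=
  WithLp.toLp 2 fun l =>
    ∑ k, (2 * Real.pi * Complex.I * (ξ k : ℂ)) * ∫ η, V η k * V (ξ - η) l

/-- For `V = v̂`, the Fourier transform of `𝒫 div (v ⊗ v)`. -/
def nonlinearHat (V : R3 → C3) (ξ : R3) : C3 := leraySymbol ξ (divTensorHat V ξ)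

/-- The symbol of the heat semigroup `exp (tνΔ)`. -/
def heatSymbol (ν t : ℝ) (ξ : R3) : ℝ := Real.exp (-ν * t * (2 * Real.pi * ‖ξ‖) ^ 2)

/-- `u` is a (mild) solution in `L²([0,T]; χ⁰)` of the Navier-Stokes system
`∂ₜu - νΔu = 𝒫 div (u ⊗ u)`, `div u = 0`, `u(0) = u₀`, that is, a fixed point of
`u ↦ exp (tνΔ) u₀ + ∫₀ᵗ exp ((t-s)νΔ) 𝒫 div (u ⊗ u)(s) ds`.
(`-u` solves the system with the opposite sign of the nonlinear term and data `-u₀`.)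
As an element of `L²([0,T]; χ⁰)`, `u` matters for almost every time only. -/
structure IsSolution (ν : ℝ) (u₀ : Field3) (T : ℝ) (u : ℝ → Field3) : Prop where
  memL2 : MemLpChi 2 0 T u
  divFree : ∀ᵐ t ∂(volume.restrict (Icc 0 T)), IsDivFree (u t)
  duhamel : ∃ (U₀ : R3 → C3) (U : ℝ → R3 → C3),
    HasFourierDensity u₀ U₀ ∧ HasSpaceTimeDensity (Icc 0 T) u U ∧
    ∀ᵐ t ∂(volume.restrict (Icc 0 T)), ∀ᵐ ξ,
      U t ξ = heatSymbol ν t ξ • U₀ ξ +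
        ∫ s in (0 : ℝ)..t, heatSymbol ν (t - s) ξ • nonlinearHat (U s) ξ

/-- `u ∈ C([0,T]; χ⁻¹) ∩ L¹([0,T]; χ¹) ∩ L^∞([0,T]; χ⁻¹)`. -/
structure IsRegular (T : ℝ) (u : ℝ → Field3) : Prop where
  cont : MemCChi (-1) T u
  memL1 : MemLpChi 1 1 T u
  memLinfty : MemLpChi ⊤ (-1) T u

/-- The maximal time of existence: the supremum of all `T > 0` such that there is a
solution in `L²([0,T]; χ⁰)`. -/
def maxTime (ν : ℝ) (u₀ : Field3) : ℝ≥0∞ :=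
  ⨆ (T : ℝ) (_ : 0 < T ∧ ∃ u, IsSolution ν u₀ T u), ENNReal.ofReal T

end ChiNS

end

/-!
In frequency space the Duhamel formula is bounded by positive integrals. By Fubini
`‖𝒫 div (u ⊗ u)‖_{χ⁻¹} ≤ ‖u‖²_{χ⁰}`, and integrating the heat kernel in time gives
`‖u(t)‖_{χ⁻¹} + ν ∫₀ᵗ ‖u‖_{χ¹} ≤ ‖u₀‖_{χ⁻¹} + ∫₀ᵗ ‖𝒫 div (u ⊗ u)‖_{χ⁻¹}`. Together with the
interpolation inequality `‖u‖²_{χ⁰} ≤ ‖u‖_{χ⁻¹} ‖u‖_{χ¹}` this makes the Duhamel map, for a given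
past on `[0,a]`, a contraction of a ball of `L²([a,b]; χ⁰)` of radius depending on `ν` only, as soon
as its value at `0` is small; by absolute continuity of the integral, that holds for `b` close to
`a`. A solution on `[0,T]` with `T < ∞` can therefore always be continued, which is the blow-up
criterion. For `‖u₀‖_{χ⁻¹} < ν` the energy estimate and a first-time argument bound the norm of `u`
in `L²([0,T]; χ⁰)` uniformly in `T`.
-/

noncomputable section

namespace ChiNS

section SchwartzPairing

variable {E F : Type*} [NormedAddCommGroup E] [NormedSpace ℝ E] [FiniteDimensional ℝ E]
  [MeasurableSpace E] {μ : Measure E} [NormedAddCommGroup F] [NormedSpace ℂ F]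
  {g : E → F}

theorem locallyIntegrable_of_forall_schwartz [OpensMeasurableSpace E]
    (h : ∀ φ : 𝓢(E, ℂ), Integrable (fun ξ => φ ξ • g ξ) μ) : LocallyIntegrable g μ := by
  intro x
  let b : ContDiffBump x := ⟨1, 2, one_pos, one_lt_two⟩
  have hsupp : HasCompactSupport (Complex.ofRealCLM ∘ b) := b.hasCompactSupport.comp_left rfl
  have hsmooth : ContDiff ℝ (⊤ : ℕ∞) (Complex.ofRealCLM ∘ b) :=
    Complex.ofRealCLM.contDiff.comp b.contDiff
  refine ⟨Metric.closedBall x 1, Metric.closedBall_mem_nhds x one_pos, ?_⟩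
  refine (h (hsupp.toSchwartzMap hsmooth)).integrableOn.congr ?_
  filter_upwards [ae_restrict_mem Metric.isClosed_closedBall.measurableSet] with ξ hξ
  have hb : b ξ = 1 := b.one_of_mem_closedBall hξ
  simp [hb]

theorem ae_eq_zero_of_forall_schwartz [BorelSpace E] [CompleteSpace F]
    (hi : ∀ φ : 𝓢(E, ℂ), Integrable (fun ξ => φ ξ • g ξ) μ)
    (h : ∀ φ : 𝓢(E, ℂ), ∫ ξ, φ ξ • g ξ ∂μ = 0) : g =ᵐ[μ] 0 := by
  refine ae_eq_zero_of_integral_contDiff_smul_eq_zero (locallyIntegrable_of_forall_schwartz hi)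
    fun b hb hc => ?_
  have hsupp : HasCompactSupport (Complex.ofRealCLM ∘ b) := hc.comp_left rfl
  simpa using h (hsupp.toSchwartzMap (Complex.ofRealCLM.contDiff.comp hb))

end SchwartzPairing

theorem sq_lintegral_le_lintegral_mul_lintegral {α : Type*} [MeasurableSpace α] {μ : Measure α}
    {f g h : α → ℝ≥0∞} (hf : AEMeasurable f μ) (hg : AEMeasurable g μ)
    (hh : ∀ᵐ x ∂μ, h x ^ 2 ≤ f x * g x) :
    (∫⁻ x, h x ∂μ) ^ 2 ≤ (∫⁻ x, f x ∂μ) * ∫⁻ x, g x ∂μ := by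
  have sqrt_sq (a : ℝ≥0∞) : (a ^ (1 / 2 : ℝ)) ^ 2 = a := by
    rw [← ENNReal.rpow_mul_natCast]; norm_num
  have sq_sqrt (a : ℝ≥0∞) : (a ^ 2) ^ (1 / 2 : ℝ) = a := by
    rw [← ENNReal.rpow_natCast_mul]; norm_num
  have hle : ∫⁻ x, h x ∂μ ≤ ∫⁻ x, f x ^ (1 / 2 : ℝ) * g x ^ (1 / 2 : ℝ) ∂μ := by
    refine lintegral_mono_ae (hh.mono fun x hx => ?_)
    rw [← ENNReal.mul_rpow_of_nonneg _ _ (by norm_num), ← sq_sqrt (h x)]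
    gcongr
  calc (∫⁻ x, h x ∂μ) ^ 2
      ≤ ((∫⁻ x, f x ∂μ) ^ (1 / 2 : ℝ) * (∫⁻ x, g x ∂μ) ^ (1 / 2 : ℝ)) ^ 2 := by
        gcongr
        exact hle.trans (ENNReal.lintegral_mul_norm_pow_le hf hg (by norm_num) (by norm_num)
          (by norm_num))
    _ = _ := by rw [mul_pow, sqrt_sq, sqrt_sq]

theorem ofReal_zpow_neg_one_mul_ofReal_le_one (x : ℝ) :
    ENNReal.ofReal (x ^ (-1 : ℤ)) * ENNReal.ofReal x ≤ 1 := by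
  rcases le_or_gt x 0 with hx | hx
  · simp [ENNReal.ofReal_of_nonpos hx]
  · rw [← ENNReal.ofReal_mul (by positivity), zpow_neg_one, inv_mul_cancel₀ hx.ne',
      ENNReal.ofReal_one]

section DensityNorm

variable {E F : Type*} [NormedAddCommGroup E] [MeasureSpace E] [NormedAddCommGroup F] {s : ℤ}
  {f g h : E → F}

/-- The weighted norm `∫ |2πξ|^s |g(ξ)| dξ` of a function `g` of the frequency, which is the
`χ^s` norm of the field with Fourier transform `g`. The frequency is that of Mathlib's `𝓕`. -/
def densityNorm (s : ℤ) (g : E → F) : ℝ≥0∞ :=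
  ∫⁻ ξ, ENNReal.ofReal ((2 * Real.pi * ‖ξ‖) ^ s) * ‖g ξ‖ₑ

theorem densityNorm_zero_right : densityNorm s (0 : E → F) = 0 := by
  simp [densityNorm]

theorem densityNorm_zero_left (g : E → F) : densityNorm 0 g = ∫⁻ ξ, ‖g ξ‖ₑ := by
  simp [densityNorm]

theorem densityNorm_congr_enorm {F' : Type*} [NormedAddCommGroup F'] {g' : E → F'}
    (H : ∀ᵐ ξ, ‖g ξ‖ₑ = ‖g' ξ‖ₑ) : densityNorm s g = densityNorm s g' :=
  lintegral_congr_ae (H.mono fun ξ hξ => by simp only [hξ])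

theorem densityNorm_congr (H : g =ᵐ[volume] h) : densityNorm s g = densityNorm s h :=
  densityNorm_congr_enorm (H.mono fun ξ hξ => by rw [hξ])

theorem densityNorm_sub_comm : densityNorm s (g - h) = densityNorm s (h - g) :=
  densityNorm_congr_enorm (.of_forall fun ξ => by
    rw [Pi.sub_apply, Pi.sub_apply, enorm_sub_rev])

theorem densityNorm_sub_eq_zero (H : g =ᵐ[volume] h) : densityNorm s (g - h) = 0 := by
  rw [densityNorm_congr H.sub_eq, densityNorm_zero_right]

variable [MeasurableSpace F] [BorelSpace F]

theorem ae_eq_of_densityNorm_zero_sub_eq_zero [SecondCountableTopology F] (hg : Measurable g)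
    (hh : Measurable h) (H : densityNorm 0 (g - h) = 0) : g =ᵐ[volume] h := by
  rw [densityNorm_zero_left, lintegral_eq_zero_iff (hg.sub hh).enorm] at H
  filter_upwards [H] with ξ hξ
  simpa [sub_eq_zero] using hξ

variable [BorelSpace E]

@[fun_prop]
theorem measurable_weight (s : ℤ) :
    Measurable fun ξ : E => ENNReal.ofReal ((2 * Real.pi * ‖ξ‖) ^ s) :=
  ENNReal.measurable_ofReal.comp ((measurable_norm.const_mul _).pow_const s)

theorem sq_densityNorm_zero_le [NullSingletonClass (volume : Measure E)] (hg : Measurable g) :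
    densityNorm 0 g ^ 2 ≤ densityNorm (-1) g * densityNorm 1 g := by
  rw [densityNorm_zero_left]
  refine sq_lintegral_le_lintegral_mul_lintegral (by fun_prop) (by fun_prop) ?_
  filter_upwards [Measure.ae_ne volume (0 : E)] with ξ hξ
  have hpos : 0 < 2 * Real.pi * ‖ξ‖ := by positivity
  have hweight : ENNReal.ofReal ((2 * Real.pi * ‖ξ‖) ^ (-1 : ℤ)) *
      ENNReal.ofReal ((2 * Real.pi * ‖ξ‖) ^ (1 : ℤ)) = 1 := by
    rw [← ENNReal.ofReal_mul (by positivity), zpow_neg_one, zpow_one, inv_mul_cancel₀ hpos.ne',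
      ENNReal.ofReal_one]
  rw [mul_mul_mul_comm, hweight, one_mul, sq]

theorem densityNorm_sub_le [SecondCountableTopology F] (hf : Measurable f) (hg : Measurable g) :
    densityNorm s (f - h) ≤ densityNorm s (f - g) + densityNorm s (g - h) := by
  rw [densityNorm, densityNorm, densityNorm, ← lintegral_add_left (by fun_prop)]
  refine lintegral_mono fun ξ => ?_
  rw [← mul_add]
  gcongr
  simpa using enorm_add_le (f ξ - g ξ) (g ξ - h ξ)

theorem densityNorm_le_sub_add [SecondCountableTopology F] (hf : Measurable f)
    (hg : Measurable g) : densityNorm s f ≤ densityNorm s (f - g) + densityNorm s g := by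
  simpa using densityNorm_sub_le (h := 0) hf hg

variable {α : Type*} [MeasurableSpace α] {U : α → E → F}

@[fun_prop]
theorem measurable_densityNorm [SFinite (volume : Measure E)] (s : ℤ)
    (hU : Measurable (Function.uncurry U)) : Measurable fun x => densityNorm s (U x) := by
  have hm : Measurable (Function.uncurry fun x ξ =>
      ENNReal.ofReal ((2 * Real.pi * ‖ξ‖) ^ s) * ‖U x ξ‖ₑ) :=
    ((measurable_weight s).comp measurable_snd).mul hU.enorm
  exact hm.lintegral_prod_right

theorem lintegral_densityNorm [SFinite (volume : Measure E)] {μ : Measure α} [SFinite μ] (s : ℤ)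
    (hU : Measurable (Function.uncurry U)) :
    ∫⁻ x, densityNorm s (U x) ∂μ =
      ∫⁻ ξ, ENNReal.ofReal ((2 * Real.pi * ‖ξ‖) ^ s) * ∫⁻ x, ‖U x ξ‖ₑ ∂μ := by
  have hm : Measurable (Function.uncurry fun x ξ =>
      ENNReal.ofReal ((2 * Real.pi * ‖ξ‖) ^ s) * ‖U x ξ‖ₑ) :=
    ((measurable_weight s).comp measurable_snd).mul hU.enorm
  simp only [densityNorm]
  rw [lintegral_lintegral_swap hm.aemeasurable]
  exact lintegral_congr fun ξ => lintegral_const_mul' _ _ ENNReal.ofReal_ne_top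

end DensityNorm

namespace HasFourierDensity

variable {f f' : Field3} {g g' : R3 → C3}

theorem congr (h : HasFourierDensity f g) (hg : g =ᵐ[volume] g') : HasFourierDensity f g' := by
  intro φ
  have hφ : (fun ξ => φ ξ • g ξ) =ᵐ[volume] fun ξ => φ ξ • g' ξ :=
    hg.mono fun ξ hξ => by simp only [hξ]
  exact ⟨(h φ).1.congr hφ, (h φ).2.trans (integral_congr_ae hφ)⟩

theorem sub (h : HasFourierDensity f g) (h' : HasFourierDensity f' g') :
    HasFourierDensity (f - f') (g - g') := by
  intro φ
  simp only [Pi.sub_apply, smul_sub]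
  refine ⟨(h φ).1.sub (h' φ).1, ?_⟩
  rw [integral_sub (h φ).1 (h' φ).1, ← (h φ).2, ← (h' φ).2]
  rfl

theorem ae_eq (h : HasFourierDensity f g) (h' : HasFourierDensity f g') : g =ᵐ[volume] g' := by
  have hsub : HasFourierDensity 0 (g - g') := by simpa using h.sub h'
  have hzero : g - g' =ᵐ[volume] 0 :=
    ae_eq_zero_of_forall_schwartz (fun φ => (hsub φ).1) fun φ => (hsub φ).2.symm
  exact sub_ae_eq_zero _ _ |>.1 hzero

theorem unique (h : HasFourierDensity f g) (h' : HasFourierDensity f' g) : f = f' := by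
  have hhat : 𝓕 f = 𝓕 f' := by
    ext1 φ
    rw [(h φ).2, (h' φ).2]
  simpa using congrArg (fun q : Field3 => 𝓕⁻ q) hhat

theorem chiNorm_eq (h : HasFourierDensity f g) (s : ℤ) : chiNorm s f = densityNorm s g :=
  le_antisymm (iInf₂_le g h) (le_iInf₂ fun _ h' => (densityNorm_congr (h.ae_eq h')).le)

theorem apply_eq (h : HasFourierDensity f g) (φ : 𝓢(R3, ℂ)) : f φ = ∫ ξ, (𝓕⁻ φ) ξ • g ξ := by
  rw [← (h (𝓕⁻ φ)).2, TemperedDistribution.fourier_apply, FourierTransform.fourier_fourierInv_eq]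

end HasFourierDensity

theorem MemChi.exists_measurable_density {f : Field3} {s : ℤ} (hf : MemChi s f) :
    ∃ g, Measurable g ∧ HasFourierDensity f g ∧ densityNorm s g ≠ ⊤ := by
  obtain ⟨g, hg⟩ := iInf_lt_top.1 hf
  obtain ⟨h, hs⟩ := iInf_lt_top.1 hg
  have hm : AEStronglyMeasurable g :=
    (locallyIntegrable_of_forall_schwartz fun φ => (h φ).1).aestronglyMeasurable
  exact ⟨hm.mk g, hm.stronglyMeasurable_mk.measurable, h.congr hm.ae_eq_mk,
    (densityNorm_congr hm.ae_eq_mk).symm.trans_ne hs.ne⟩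

section Existence

variable {g : R3 → C3} {c : R3 → ℂ}

theorem exists_hasFourierDensity_of_integrable_inv_smul (hc : c.HasTemperateGrowth)
    (hc₀ : ∀ ξ, c ξ ≠ 0) (hg : Integrable (fun ξ => (c ξ)⁻¹ • g ξ)) :
    ∃ f, HasFourierDensity f g := by
  have hL := memLp_one_iff_integrable.2 hg
  refine ⟨𝓕⁻ (TemperedDistribution.smulLeftCLM C3 c (hL.toLp _ : Lp C3 1 volume)), fun φ => ?_⟩
  have hcancel (ξ : R3) : (SchwartzMap.smulLeftCLM ℂ c φ) ξ • (c ξ)⁻¹ • g ξ = φ ξ • g ξ := by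
    rw [SchwartzMap.smulLeftCLM_apply_apply hc, smul_smul, smul_eq_mul, mul_right_comm,
      mul_inv_cancel₀ (hc₀ ξ), one_mul]
  constructor
  · simp_rw [← hcancel]
    exact hg.bdd_smul (φ := (SchwartzMap.smulLeftCLM ℂ c φ : R3 → ℂ))
      (SchwartzMap.seminorm ℂ 0 0 (SchwartzMap.smulLeftCLM ℂ c φ))
      (SchwartzMap.continuous _).aestronglyMeasurable
      (.of_forall fun ξ => SchwartzMap.norm_le_seminorm ℂ _ ξ)
  · rw [FourierTransform.fourier_fourierInv_eq, TemperedDistribution.smulLeftCLM_apply_apply,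
      Lp.toTemperedDistribution_apply]
    refine integral_congr_ae (hL.coeFn_toLp.mono fun ξ hξ => ?_)
    simp only [hξ, hcancel]

theorem exists_hasFourierDensity (hm : AEStronglyMeasurable g)
    (hg : densityNorm (-1) g ≠ ⊤) : ∃ f, HasFourierDensity f g := by
  have hpos (ξ : R3) : (0 : ℝ) < 1 + ‖ξ‖ ^ 2 := by positivity
  have hc : (fun ξ : R3 => ((1 + ‖ξ‖ ^ 2 : ℝ) : ℂ)).HasTemperateGrowth := by fun_prop
  refine exists_hasFourierDensity_of_integrable_inv_smul hc
    (fun ξ => Complex.ofReal_ne_zero.2 (hpos ξ).ne') ⟨?_, ?_⟩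
  · exact (hc.1.continuous.measurable.inv.aestronglyMeasurable (μ := volume)).smul hm
  have hbound : ∀ᵐ ξ : R3, ‖((1 + ‖ξ‖ ^ 2 : ℝ) : ℂ)⁻¹ • g ξ‖ₑ ≤ ENNReal.ofReal (2 * Real.pi) *
      (ENNReal.ofReal ((2 * Real.pi * ‖ξ‖) ^ (-1 : ℤ)) * ‖g ξ‖ₑ) := by
    filter_upwards [Measure.ae_ne volume (0 : R3)] with ξ hξ
    rw [enorm_smul, ← mul_assoc, ← ENNReal.ofReal_mul (by positivity), ← ofReal_norm, norm_inv,
      Complex.norm_real, Real.norm_of_nonneg (hpos ξ).le, zpow_neg_one, mul_inv, ← mul_assoc,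
      mul_inv_cancel₀ (by positivity), one_mul]
    gcongr
    nlinarith [sq_nonneg (‖ξ‖ - 1)]
  refine (lintegral_mono_ae hbound).trans_lt ?_
  rw [lintegral_const_mul' _ _ ENNReal.ofReal_ne_top]
  exact ENNReal.mul_lt_top ENNReal.ofReal_lt_top hg.lt_top

end Existence

section Divergence

/-- The vector `ξ ∈ ℝ³`, regarded as an element of `ℂ³`; `divTensorHat` and `leraySymbol` contract
with it, which makes the first an inner product and the second an orthogonal projection. -/
def complexify (ξ : R3) : C3 := WithLp.toLp 2 fun j => (ξ j : ℂ)

theorem norm_complexify (ξ : R3) : ‖complexify ξ‖ = ‖ξ‖ := by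
  simp [complexify, EuclideanSpace.norm_eq]

theorem inner_complexify (ξ : R3) (a : C3) :
    inner ℂ (complexify ξ) a = ∑ k, (ξ k : ℂ) * a k := by
  simp [complexify, PiLp.inner_apply, mul_comm]

namespace HasFourierDensity

variable {f : Field3} {g : R3 → C3}

theorem integrable_apply (h : HasFourierDensity f g) (φ : 𝓢(R3, ℂ)) (j : Fin 3) :
    Integrable (fun ξ => φ ξ * g ξ j) := by
  simpa using (EuclideanSpace.proj (𝕜 := ℂ) j).integrable_comp (h φ).1

theorem apply_apply (h : HasFourierDensity f g) (φ : 𝓢(R3, ℂ)) (j : Fin 3) :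
    f φ j = ∫ ξ, (𝓕⁻ φ) ξ * g ξ j := by
  rw [h.apply_eq φ]
  simpa using ((EuclideanSpace.proj (𝕜 := ℂ) j).integral_comp_comm (h (𝓕⁻ φ)).1).symm

theorem lineDeriv (h : HasFourierDensity f g) (m : R3) :
    HasFourierDensity (∂_{m} f) fun ξ => (2 * Real.pi * Complex.I * (inner ℝ ξ m : ℝ)) • g ξ := by
  intro φ
  have hm : (inner ℝ · m : R3 → ℝ).HasTemperateGrowth := by fun_prop
  set ψ := (2 * Real.pi * Complex.I) • SchwartzMap.smulLeftCLM ℂ (inner ℝ · m : R3 → ℝ) φ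
  have hψ (ξ : R3) : ψ ξ • g ξ = φ ξ • (2 * Real.pi * Complex.I * (inner ℝ ξ m : ℝ)) • g ξ := by
    rw [smul_smul, smul_apply, SchwartzMap.smulLeftCLM_apply_apply hm, smul_eq_mul,
      Complex.real_smul]
    ring_nf
  simp_rw [← hψ]
  refine ⟨(h ψ).1, (h ψ).2 ▸ ?_⟩
  rw [TemperedDistribution.fourier_lineDerivOp_eq]
  simp [ψ, TemperedDistribution.smulLeftCLM_apply_apply, ← SchwartzMap.smulLeftCLM_ofReal ℂ hm]

theorem isDivFree_iff (h : HasFourierDensity f g) :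
    IsDivFree f ↔ ∀ᵐ ξ, inner ℂ (complexify ξ) (g ξ) = 0 := by
  have hi (φ : 𝓢(R3, ℂ)) (j : Fin 3) :=
    (h.lineDeriv (EuclideanSpace.single j 1)).integrable_apply φ j
  have hsum (φ : 𝓢(R3, ℂ)) (ξ : R3) : ∑ j, φ ξ *
      ((2 * Real.pi * Complex.I * (inner ℝ ξ (EuclideanSpace.single j 1) : ℝ)) • g ξ) j =
        φ ξ • (2 * Real.pi * Complex.I * inner ℂ (complexify ξ) (g ξ)) := by
    simp only [inner_complexify, EuclideanSpace.inner_single_right, PiLp.smul_apply, smul_eq_mul,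
      Finset.mul_sum]
    simp [mul_assoc]
  have hdiv (φ : 𝓢(R3, ℂ)) : ∑ j : Fin 3, (∂_{EuclideanSpace.single j (1 : ℝ)} f) φ j =
      ∫ ξ, (𝓕⁻ φ) ξ • (2 * Real.pi * Complex.I * inner ℂ (complexify ξ) (g ξ)) := by
    simp_rw [fun j => (h.lineDeriv (EuclideanSpace.single j 1)).apply_apply φ j, ← hsum]
    exact (integral_finsetSum _ fun j _ => hi (𝓕⁻ φ) j).symm
  constructor
  · intro hf
    have hzero := ae_eq_zero_of_forall_schwartz (μ := volume)
      (g := fun ξ => 2 * Real.pi * Complex.I * inner ℂ (complexify ξ) (g ξ))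
      (fun φ => by simp_rw [← hsum]; exact integrable_finsetSum _ fun j _ => hi φ j)
      fun φ => by simpa using (hdiv (𝓕 φ)).symm.trans (hf _)
    exact hzero.mono fun ξ hξ => (mul_eq_zero.1 hξ).resolve_left Complex.two_pi_I_ne_zero
  · intro hg φ
    rw [hdiv, integral_eq_zero_of_ae]
    filter_upwards [hg] with ξ hξ
    simp [hξ]

end HasFourierDensity

end Divergence

section Reality

/-- Componentwise complex conjugation on `ℂ³`. -/
def conjC3 : C3 ≃ₗᵢ[ℝ] C3 := LinearIsometryEquiv.piLpCongrRight 2 fun _ => Complex.conjLIE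

theorem conjC3_apply (a : C3) (j : Fin 3) : conjC3 a j = starRingEnd ℂ (a j) := by
  simp [conjC3]

theorem conjC3_smul (c : ℂ) (a : C3) : conjC3 (c • a) = starRingEnd ℂ c • conjC3 a := by
  ext j
  simp [conjC3_apply]

/-- The Fourier transform of the complex conjugate of the field with Fourier transform `g`. -/
def conjReflect (g : R3 → C3) (ξ : R3) : C3 := conjC3 (g (-ξ))

/-- The complex conjugate of a Schwartz function. -/
def conjSchwartz (φ : 𝓢(R3, ℂ)) : 𝓢(R3, ℂ) :=
  SchwartzMap.postcompCLM (𝕜 := ℝ) (Complex.conjCLE : ℂ →L[ℝ] ℂ) φ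

theorem conjSchwartz_apply (φ : 𝓢(R3, ℂ)) (x : R3) :
    conjSchwartz φ x = starRingEnd ℂ (φ x) := by
  simp [conjSchwartz]

theorem conjSchwartz_conjSchwartz (φ : 𝓢(R3, ℂ)) : conjSchwartz (conjSchwartz φ) = φ := by
  ext x
  simp only [conjSchwartz_apply, Complex.conj_conj]

theorem conj_fourierInv (φ : 𝓢(R3, ℂ)) (ξ : R3) :
    starRingEnd ℂ ((𝓕⁻ φ) ξ) = (𝓕⁻ (conjSchwartz φ)) (-ξ) := by
  rw [SchwartzMap.fourierInv_coe, SchwartzMap.fourierInv_coe, Real.fourierInv_eq',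
    Real.fourierInv_eq', ← integral_conj]
  refine integral_congr_ae (.of_forall fun x => ?_)
  simp [conjSchwartz_apply, ← Complex.exp_conj, Complex.conj_ofNat]

theorem densityNorm_conjReflect (s : ℤ) (g : R3 → C3) :
    densityNorm s (conjReflect g) = densityNorm s g := by
  rw [densityNorm, ← lintegral_neg_eq_self, densityNorm]
  simp only [conjReflect, norm_neg, neg_neg, LinearIsometryEquiv.enorm_map]

theorem conjReflect_congr {g h : R3 → C3} (H : g =ᵐ[volume] h) :
    conjReflect g =ᵐ[volume] conjReflect h := by
  have hneg := (Measure.measurePreserving_neg (volume : Measure R3)).quasiMeasurePreserving.ae_eq H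
  exact hneg.mono fun ξ hξ => congrArg conjC3 hξ

theorem IsRealField.conjC3_apply {f : Field3} (hf : IsRealField f) (φ : 𝓢(R3, ℂ)) :
    conjC3 (f φ) = f (conjSchwartz φ) := by
  ext j
  have hre : (f (φ + conjSchwartz φ) j).im = 0 :=
    hf _ (fun x => by simp [conjSchwartz_apply]) j
  have him : (f (Complex.I • (φ - conjSchwartz φ)) j).im = 0 :=
    hf _ (fun x => by simp [conjSchwartz_apply]) j
  rw [map_add, PiLp.add_apply, Complex.add_im] at hre
  rw [map_smul, map_sub, PiLp.smul_apply, PiLp.sub_apply, smul_eq_mul, Complex.I_mul_im,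
    Complex.sub_re] at him
  rw [ChiNS.conjC3_apply]
  refine Complex.ext ?_ ?_
  · rw [Complex.conj_re]; linarith
  · rw [Complex.conj_im]; linarith

namespace HasFourierDensity

variable {f : Field3} {g : R3 → C3}

theorem conjC3_apply_eq (h : HasFourierDensity f g) (φ : 𝓢(R3, ℂ)) :
    conjC3 (f φ) = ∫ ξ, (𝓕⁻ (conjSchwartz φ)) ξ • conjReflect g ξ := by
  rw [h.apply_eq, ← integral_neg_eq_self]
  refine (conjC3.toContinuousLinearEquiv.integral_comp_comm _).symm.trans
    (integral_congr_ae (.of_forall fun ξ => ?_))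
  simp [conjReflect, conjC3_smul, conj_fourierInv]

theorem integrable_smul_conjReflect (h : HasFourierDensity f g) (φ : 𝓢(R3, ℂ)) :
    Integrable fun ξ => φ ξ • conjReflect g ξ := by
  have hφ := (h (conjSchwartz (SchwartzMap.compCLMOfContinuousLinearEquiv ℂ
    (ContinuousLinearEquiv.neg ℝ) φ))).1
  refine (conjC3.toContinuousLinearEquiv.toContinuousLinearMap.integrable_comp hφ).comp_neg.congr
    (.of_forall fun ξ => ?_)
  simp [conjSchwartz_apply, conjReflect, conjC3_smul]

theorem isRealField_iff (h : HasFourierDensity f g) :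
    IsRealField f ↔ conjReflect g =ᵐ[volume] g := by
  constructor
  · intro hf
    have hconj : HasFourierDensity f (conjReflect g) := fun φ => by
      refine ⟨h.integrable_smul_conjReflect φ, ?_⟩
      rw [TemperedDistribution.fourier_apply, ← conjSchwartz_conjSchwartz (𝓕 φ),
        ← hf.conjC3_apply, h.conjC3_apply_eq, conjSchwartz_conjSchwartz,
        FourierTransform.fourierInv_fourier_eq]
    exact hconj.ae_eq h
  · intro hg φ hφ j
    have hself : conjSchwartz φ = φ := by
      ext x
      rw [conjSchwartz_apply, Complex.conj_eq_iff_im, hφ x]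
    have hconj : conjC3 (f φ) = f φ := by
      rw [h.conjC3_apply_eq, hself, h.apply_eq]
      exact integral_congr_ae (hg.mono fun ξ hξ => by simp only [hξ])
    rw [← Complex.conj_eq_iff_im, ← conjC3_apply, hconj]

end HasFourierDensity

end Reality

section LerayProjection

theorem leraySymbol_eq_starProjection (ξ : R3) (a : C3) :
    leraySymbol ξ a = (ℂ ∙ complexify ξ)ᗮ.starProjection a := by
  rw [Submodule.starProjection_orthogonal', sub_apply, one_apply_eq_self,
    Submodule.starProjection_singleton, norm_complexify, inner_complexify]
  ext j
  simp only [leraySymbol, complexify, PiLp.sub_apply, PiLp.smul_apply, smul_eq_mul]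
  rw [div_mul_eq_mul_div, Finset.sum_mul]
  congr! 3
  ring

theorem inner_leraySymbol (ξ : R3) (a : C3) : inner ℂ (complexify ξ) (leraySymbol ξ a) = 0 := by
  rw [leraySymbol_eq_starProjection]
  exact Submodule.mem_orthogonal_singleton_iff_inner_right.1
    (Submodule.starProjection_apply_mem _ _)

theorem leraySymbol_sub (ξ : R3) (a b : C3) :
    leraySymbol ξ (a - b) = leraySymbol ξ a - leraySymbol ξ b := by
  simp only [leraySymbol_eq_starProjection, map_sub]

theorem enorm_leraySymbol_le (ξ : R3) (a : C3) : ‖leraySymbol ξ a‖ₑ ≤ ‖a‖ₑ := by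
  rw [leraySymbol_eq_starProjection]
  exact enorm_le_iff_norm_le.2 (Submodule.norm_starProjection_apply_le _ _)

theorem leraySymbol_conjC3 (ξ : R3) (a : C3) :
    leraySymbol ξ (conjC3 a) = conjC3 (leraySymbol (-ξ) a) := by
  ext j
  simp [leraySymbol, conjC3_apply]

end LerayProjection

theorem lintegral_lconvolution {G : Type*} [AddGroup G] [MeasurableSpace G] [MeasurableAdd₂ G]
    [MeasurableNeg G] {μ : Measure G} [μ.IsAddLeftInvariant] [SFinite μ] {f g : G → ℝ≥0∞}
    (hf : Measurable f) (hg : Measurable g) :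
    ∫⁻ x, (f ⋆ₗ[μ] g) x ∂μ = (∫⁻ x, f x ∂μ) * ∫⁻ x, g x ∂μ := by
  simp only [lconvolution_def]
  rw [lintegral_lintegral_swap (by fun_prop), ← lintegral_mul_const _ hf]
  refine lintegral_congr fun y => ?_
  rw [lintegral_const_mul _ (by fun_prop), lintegral_add_left_eq_self g (-y)]

theorem enorm_inner_complexify_smul_le (ξ : R3) (a b : C3) :
    ‖inner ℂ (complexify ξ) a • b‖ₑ ≤ ‖ξ‖ₑ * (‖a‖ₑ * ‖b‖ₑ) := by
  rw [enorm_smul, ← mul_assoc]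
  gcongr
  simp only [← ofReal_norm]
  rw [← ENNReal.ofReal_mul (norm_nonneg _), ← norm_complexify]
  exact ENNReal.ofReal_le_ofReal (norm_inner_le_norm _ _)

section BilinearTerm

variable {V W : R3 → C3} {ξ : R3}

theorem integrable_inner_complexify_smul (hV : Measurable V)
    (hfin : ((fun η => ‖V η‖ₑ) ⋆ₗ (fun η => ‖V η‖ₑ)) ξ ≠ ⊤) :
    Integrable fun η => inner ℂ (complexify ξ) (V η) • V (ξ - η) := by
  refine ⟨by fun_prop, (lintegral_mono fun η => enorm_inner_complexify_smul_le _ _ _).trans_lt ?_⟩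
  rw [lintegral_const_mul' _ _ enorm_ne_top]
  simp only [lconvolution_def, neg_add_eq_sub] at hfin
  exact ENNReal.mul_lt_top enorm_lt_top hfin.lt_top

theorem divTensorHat_eq_smul_integral (hV : Measurable V)
    (hfin : ((fun η => ‖V η‖ₑ) ⋆ₗ (fun η => ‖V η‖ₑ)) ξ ≠ ⊤) :
    divTensorHat V ξ =
      (2 * Real.pi * Complex.I) • ∫ η, inner ℂ (complexify ξ) (V η) • V (ξ - η) := by
  have hbound : ∫⁻ η, ‖V η‖ₑ * ‖V (ξ - η)‖ₑ < ⊤ := by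
    simpa only [lconvolution_def, neg_add_eq_sub] using hfin.lt_top
  have hkl (k l : Fin 3) : Integrable fun η => V η k * V (ξ - η) l := by
    have hm : Measurable fun η => V η k * V (ξ - η) l := by fun_prop
    refine ⟨hm.aestronglyMeasurable, lt_of_le_of_lt (lintegral_mono fun η => ?_) hbound⟩
    rw [enorm_mul]
    gcongr <;> exact enorm_le_iff_norm_le.2 (PiLp.norm_apply_le _ _)
  ext l
  have hproj := (EuclideanSpace.proj (𝕜 := ℂ) l).integral_comp_comm
    (integrable_inner_complexify_smul hV hfin)
  simp only [EuclideanSpace.coe_proj, PiLp.smul_apply, smul_eq_mul, inner_complexify,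
    Finset.sum_mul, mul_assoc] at hproj
  simp only [divTensorHat, PiLp.smul_apply, smul_eq_mul, inner_complexify]
  rw [← hproj, integral_finsetSum (f := fun k η => (ξ k : ℂ) * (V η k * V (ξ - η) l)) _
    fun k _ => (hkl k l).const_mul _, Finset.mul_sum]
  refine Finset.sum_congr rfl fun k _ => ?_
  rw [integral_const_mul, mul_assoc]

theorem enorm_nonlinearHat_sub_le (hV : Measurable V) (hW : Measurable W)
    (hVV : ((fun η => ‖V η‖ₑ) ⋆ₗ (fun η => ‖V η‖ₑ)) ξ ≠ ⊤)
    (hWW : ((fun η => ‖W η‖ₑ) ⋆ₗ (fun η => ‖W η‖ₑ)) ξ ≠ ⊤) :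
    ‖nonlinearHat V ξ - nonlinearHat W ξ‖ₑ ≤ ENNReal.ofReal (2 * Real.pi * ‖ξ‖) *
      (((fun η => ‖(V - W) η‖ₑ) ⋆ₗ (fun η => ‖V η‖ₑ)) ξ +
        ((fun η => ‖W η‖ₑ) ⋆ₗ (fun η => ‖(V - W) η‖ₑ)) ξ) := by
  have hsplit (η : R3) : inner ℂ (complexify ξ) (V η) • V (ξ - η) -
      inner ℂ (complexify ξ) (W η) • W (ξ - η) =
        inner ℂ (complexify ξ) ((V - W) η) • V (ξ - η) +
          inner ℂ (complexify ξ) (W η) • (V - W) (ξ - η) := by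
    simp only [Pi.sub_apply, inner_sub_right, sub_smul, smul_sub]
    abel
  have hpi : ‖(2 * Real.pi * Complex.I : ℂ)‖ₑ = ENNReal.ofReal (2 * Real.pi) := by
    rw [← ofReal_norm]
    simp [abs_of_pos Real.pi_pos]
  rw [nonlinearHat, nonlinearHat, ← leraySymbol_sub]
  refine (enorm_leraySymbol_le _ _).trans ?_
  rw [divTensorHat_eq_smul_integral hV hVV, divTensorHat_eq_smul_integral hW hWW, ← smul_sub,
    ← integral_sub (integrable_inner_complexify_smul hV hVV)
      (integrable_inner_complexify_smul hW hWW), enorm_smul, hpi,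
    ENNReal.ofReal_mul (p := 2 * Real.pi) (by positivity), ofReal_norm, mul_assoc]
  gcongr
  simp only [lconvolution_def, neg_add_eq_sub]
  rw [← lintegral_add_left (by fun_prop), ← lintegral_const_mul' _ _ enorm_ne_top]
  refine (enorm_integral_le_lintegral_enorm _).trans (lintegral_mono fun η => ?_)
  rw [hsplit, mul_add]
  exact (enorm_add_le _ _).trans (add_le_add (enorm_inner_complexify_smul_le _ _ _)
    (enorm_inner_complexify_smul_le _ _ _))

theorem ae_lconvolution_enorm_ne_top (hV : Measurable V) (h : densityNorm 0 V ≠ ⊤) :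
    ∀ᵐ ξ, ((fun η => ‖V η‖ₑ) ⋆ₗ (fun η => ‖V η‖ₑ)) ξ ≠ ⊤ := by
  refine (ae_lt_top (measurable_lconvolution volume hV.enorm hV.enorm) ?_).mono fun ξ h => h.ne
  rw [lintegral_lconvolution hV.enorm hV.enorm, ← densityNorm_zero_left]
  exact ENNReal.mul_ne_top h h

theorem densityNorm_nonlinearHat_sub_le (hV : Measurable V) (hW : Measurable W)
    (hV₀ : densityNorm 0 V ≠ ⊤) (hW₀ : densityNorm 0 W ≠ ⊤) :
    densityNorm (-1) (nonlinearHat V - nonlinearHat W) ≤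
      (densityNorm 0 V + densityNorm 0 W) * densityNorm 0 (V - W) := by
  have hVW := hV.sub hW
  calc densityNorm (-1) (nonlinearHat V - nonlinearHat W)
      ≤ ∫⁻ ξ, (((fun η => ‖(V - W) η‖ₑ) ⋆ₗ (fun η => ‖V η‖ₑ)) ξ +
          ((fun η => ‖W η‖ₑ) ⋆ₗ (fun η => ‖(V - W) η‖ₑ)) ξ) := by
        refine lintegral_mono_ae ?_
        filter_upwards [ae_lconvolution_enorm_ne_top hV hV₀, ae_lconvolution_enorm_ne_top hW hW₀]
          with ξ hVV hWW
        refine (mul_le_mul_right (enorm_nonlinearHat_sub_le hV hW hVV hWW) _).trans ?_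
        rw [← mul_assoc]
        exact mul_le_of_le_one_left' (ofReal_zpow_neg_one_mul_ofReal_le_one _)
    _ = densityNorm 0 (V - W) * densityNorm 0 V + densityNorm 0 W * densityNorm 0 (V - W) := by
        simp only [densityNorm_zero_left]
        rw [lintegral_add_left (measurable_lconvolution volume hVW.enorm hV.enorm),
          lintegral_lconvolution hVW.enorm hV.enorm, lintegral_lconvolution hW.enorm hVW.enorm]
    _ = (densityNorm 0 V + densityNorm 0 W) * densityNorm 0 (V - W) := by ring

theorem nonlinearHat_zero : nonlinearHat 0 = 0 := by
  ext ξ j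
  simp [nonlinearHat, leraySymbol, divTensorHat]

theorem densityNorm_nonlinearHat_le (hV : Measurable V) :
    densityNorm (-1) (nonlinearHat V) ≤ densityNorm 0 V ^ 2 := by
  by_cases hV₀ : densityNorm 0 V = ⊤
  · simp [hV₀]
  simpa [nonlinearHat_zero, densityNorm_zero_right, sq] using
    densityNorm_nonlinearHat_sub_le hV measurable_zero hV₀
      (densityNorm_zero_right.trans_ne ENNReal.zero_ne_top)

theorem nonlinearHat_congr (h : V =ᵐ[volume] W) : nonlinearHat V = nonlinearHat W := by
  ext1 ξ
  have hξ : (fun η => V (ξ - η)) =ᵐ[volume] fun η => W (ξ - η) :=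
    (Measure.measurePreserving_sub_left volume ξ).quasiMeasurePreserving.ae_eq h
  have hconv (k l : Fin 3) : ∫ η, V η k * V (ξ - η) l = ∫ η, W η k * W (ξ - η) l := by
    refine integral_congr_ae ?_
    filter_upwards [h, hξ] with η h₁ h₂
    rw [h₁, h₂]
  simp only [nonlinearHat, divTensorHat, hconv]

theorem nonlinearHat_conjReflect (V : R3 → C3) :
    nonlinearHat (conjReflect V) = conjReflect (nonlinearHat V) := by
  have hdiv (ξ : R3) : divTensorHat (conjReflect V) ξ = conjC3 (divTensorHat V (-ξ)) := by
    ext l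
    simp only [divTensorHat, conjReflect, conjC3_apply, map_sum, map_mul, ← integral_conj]
    refine Finset.sum_congr rfl fun k _ => ?_
    rw [← integral_neg_eq_self]
    have hconv (η : R3) : -η + -ξ = -ξ - η := by abel
    simp [Complex.conj_ofNat, hconv]
  ext1 ξ
  rw [nonlinearHat, hdiv, leraySymbol_conjC3]
  rfl

theorem measurable_nonlinearHat {α : Type*} [MeasurableSpace α] {U : α → R3 → C3}
    (hU : Measurable (Function.uncurry U)) :
    Measurable (Function.uncurry fun x => nonlinearHat (U x)) := by
  have hconv (k l : Fin 3) : Measurable fun p : α × R3 => ∫ η, U p.1 η k * U p.1 (p.2 - η) l := by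
    have h : Measurable fun q : (α × R3) × R3 => U q.1.1 q.2 k * U q.1.1 (q.1.2 - q.2) l := by
      have _ : Measurable fun q : (α × R3) × R3 => U q.1.1 q.2 :=
        hU.comp (measurable_fst.fst.prodMk measurable_snd)
      have _ : Measurable fun q : (α × R3) × R3 => U q.1.1 (q.1.2 - q.2) :=
        hU.comp (measurable_fst.fst.prodMk (measurable_fst.snd.sub measurable_snd))
      fun_prop
    exact h.stronglyMeasurable.integral_prod_right'.measurable
  unfold Function.uncurry nonlinearHat leraySymbol divTensorHat
  fun_prop

end BilinearTerm

section ScalarDuhamel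

theorem ofReal_exp_add_lintegral {a s t : ℝ} (ha : 0 ≤ a) (hst : s ≤ t) :
    ENNReal.ofReal (Real.exp (-a * (t - s))) +
      ENNReal.ofReal a * ∫⁻ τ in Ioc s t, ENNReal.ofReal (Real.exp (-a * (τ - s))) = 1 := by
  have hderiv (τ : ℝ) :
      HasDerivAt (fun τ => -Real.exp (-a * (τ - s))) (a * Real.exp (-a * (τ - s))) τ :=
    (((hasDerivAt_id τ).sub_const s).const_mul (-a)).exp.neg.congr_deriv (by simp only [id]; ring)
  have hcont : Continuous fun τ => a * Real.exp (-a * (τ - s)) := by fun_prop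
  have hint := intervalIntegral.integral_eq_sub_of_hasDerivAt (fun τ _ => hderiv τ)
    (hcont.intervalIntegrable s t)
  rw [← lintegral_const_mul' _ _ ENNReal.ofReal_ne_top]
  simp only [← ENNReal.ofReal_mul ha]
  rw [← ofReal_integral_eq_lintegral_ofReal hcont.integrableOn_Ioc
      (.of_forall fun τ => by positivity), ← intervalIntegral.integral_of_le hst,
    ← ENNReal.ofReal_add (by positivity)
      (intervalIntegral.integral_nonneg hst fun τ _ => by positivity), hint]
  simp

theorem lintegral_Ioc_lintegral_Ioc_swap {K : ℝ → ℝ → ℝ≥0∞} (hK : Measurable (Function.uncurry K))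
    (a b : ℝ) :
    ∫⁻ τ in Ioc a b, ∫⁻ s in Ioc a τ, K τ s = ∫⁻ s in Ioc a b, ∫⁻ τ in Ioc s b, K τ s := by
  have hbelow : ∀ τ ∈ Ioc a b,
      ∫⁻ s in Ioc a τ, K τ s = ∫⁻ s in Ioc a b, (Iic τ).indicator (K τ) s := fun τ hτ => by
    rw [lintegral_indicator measurableSet_Iic, Measure.restrict_restrict measurableSet_Iic,
      Iic_inter_Ioc_of_le hτ.2]
  have habove : ∀ s ∈ Ioc a b,
      ∫⁻ τ in Ioc s b, K τ s = ∫⁻ τ in Ioc a b, (Iic τ).indicator (K τ) s := fun s hs => by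
    calc ∫⁻ τ in Ioc s b, K τ s = ∫⁻ τ in Ici s ∩ Ioc a b, K τ s := by
          refine setLIntegral_congr ?_
          rw [show Ici s ∩ Ioc a b = Icc s b by ext; grind]
          exact Ioc_ae_eq_Icc
      _ = ∫⁻ τ in Ioc a b, (Ici s).indicator (K · s) τ := by
          rw [lintegral_indicator measurableSet_Ici, Measure.restrict_restrict measurableSet_Ici]
  rw [setLIntegral_congr_fun measurableSet_Ioc hbelow,
    setLIntegral_congr_fun measurableSet_Ioc habove]
  exact lintegral_lintegral_swap
    (hK.indicator (measurableSet_le measurable_snd measurable_fst)).aemeasurable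

theorem scalar_duhamel_identity {a t : ℝ} (ha : 0 ≤ a) (ht : 0 ≤ t) (f : ℝ≥0∞) {G : ℝ → ℝ≥0∞}
    (hG : Measurable G) :
    (ENNReal.ofReal (Real.exp (-a * t)) * f +
        ∫⁻ s in Ioc 0 t, ENNReal.ofReal (Real.exp (-a * (t - s))) * G s) +
      ENNReal.ofReal a * ∫⁻ τ in Ioc 0 t, (ENNReal.ofReal (Real.exp (-a * τ)) * f +
        ∫⁻ s in Ioc 0 τ, ENNReal.ofReal (Real.exp (-a * (τ - s))) * G s) =
    f + ∫⁻ s in Ioc 0 t, G s := by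
  set e : ℝ → ℝ≥0∞ := fun x => ENNReal.ofReal (Real.exp (-a * x))
  have he : Measurable e := by fun_prop
  have hmass {s : ℝ} (hs : s ≤ t) :
      e (t - s) + ENNReal.ofReal a * ∫⁻ τ in Ioc s t, e (τ - s) = 1 :=
    ofReal_exp_add_lintegral ha hs
  have hdata : e t * f + ENNReal.ofReal a * ∫⁻ τ in Ioc 0 t, e τ * f = f := by
    rw [lintegral_mul_const _ he, ← mul_assoc, ← add_mul]
    simpa only [sub_zero, one_mul] using congrArg (· * f) (hmass ht)
  have hforce : (∫⁻ s in Ioc 0 t, e (t - s) * G s) +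
      ENNReal.ofReal a * ∫⁻ τ in Ioc 0 t, ∫⁻ s in Ioc 0 τ, e (τ - s) * G s =
        ∫⁻ s in Ioc 0 t, G s := by
    rw [lintegral_Ioc_lintegral_Ioc_swap (by fun_prop),
      ← lintegral_const_mul' _ _ ENNReal.ofReal_ne_top, ← lintegral_add_left (by fun_prop)]
    refine setLIntegral_congr_fun measurableSet_Ioc fun s hs => ?_
    rw [lintegral_mul_const _ (by fun_prop), ← mul_assoc, ← add_mul, hmass hs.2, one_mul]
  rw [lintegral_add_left (he.mul_const f), mul_add, add_add_add_comm]
  exact congrArg₂ (· + ·) hdata hforce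

end ScalarDuhamel

theorem ae_integrableOn_of_lintegral_densityNorm {F : Type*} [NormedAddCommGroup F]
    [MeasurableSpace F] [BorelSpace F] [SecondCountableTopology F] {N : ℝ → R3 → F} {T : ℝ}
    (hN : Measurable (Function.uncurry N))
    (h : ∫⁻ s in Ioc 0 T, densityNorm (-1) (N s) ≠ ⊤) :
    ∀ᵐ ξ, IntegrableOn (N · ξ) (Ioc 0 T) := by
  rw [lintegral_densityNorm (-1) hN] at h
  have _ : Measurable fun ξ => ∫⁻ s in Ioc 0 T, ‖N s ξ‖ₑ :=
    Measurable.lintegral_prod_left (f := fun s ξ => ‖N s ξ‖ₑ) hN.enorm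
  filter_upwards [ae_lt_top (by fun_prop) h, Measure.ae_ne volume (0 : R3)] with ξ hξ hξ₀
  have hpos : 0 < (2 * Real.pi * ‖ξ‖) ^ (-1 : ℤ) := by positivity
  exact ⟨hN.of_uncurry_right.aestronglyMeasurable,
    ENNReal.lt_top_of_mul_ne_top_right hξ.ne (ENNReal.ofReal_pos.2 hpos).ne'⟩

section Mild

variable {F : Type*} [NormedAddCommGroup F] [NormedSpace ℝ F]

/-- The Duhamel formula `exp (tνΔ) u₀ + ∫₀ᵗ exp ((t-s)νΔ) f(s) ds` for the solution of
`∂ₜu - νΔu = f`, `u(0) = u₀`, on the Fourier side: `U₀` and `N` are the transforms of the data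
`u₀` and of the force `f`. -/
def mild (ν : ℝ) (U₀ : R3 → F) (N : ℝ → R3 → F) (t : ℝ) (ξ : R3) : F :=
  heatSymbol ν t ξ • U₀ ξ + ∫ s in (0 : ℝ)..t, heatSymbol ν (t - s) ξ • N s ξ

variable {ν t T : ℝ} {ξ : R3} {U₀ U₁ : R3 → F} {N M : ℝ → R3 → F}

@[fun_prop]
theorem continuous_heatSymbol {X : Type*} [TopologicalSpace X] {τ : X → ℝ} {ζ : X → R3}
    (hτ : Continuous τ) (hζ : Continuous ζ) : Continuous fun x => heatSymbol ν (τ x) (ζ x) := by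
  unfold heatSymbol
  fun_prop

@[fun_prop]
theorem measurable_heatSymbol {X : Type*} [MeasurableSpace X] {τ : X → ℝ} {ζ : X → R3}
    (hτ : Measurable τ) (hζ : Measurable ζ) : Measurable fun x => heatSymbol ν (τ x) (ζ x) := by
  unfold heatSymbol
  fun_prop

theorem heatSymbol_eq (ν t : ℝ) (ξ : R3) :
    heatSymbol ν t ξ = Real.exp (-(ν * (2 * Real.pi * ‖ξ‖) ^ 2) * t) := by
  rw [heatSymbol]
  ring_nf

theorem heatSymbol_add (ν s t : ℝ) (ξ : R3) :
    heatSymbol ν (s + t) ξ = heatSymbol ν s ξ * heatSymbol ν t ξ := by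
  rw [heatSymbol, heatSymbol, heatSymbol, ← Real.exp_add]
  ring_nf

theorem heatSymbol_le_one (hν : 0 ≤ ν) (ht : 0 ≤ t) (ξ : R3) : heatSymbol ν t ξ ≤ 1 := by
  rw [heatSymbol_eq, neg_mul]
  exact Real.exp_le_one_iff.2 (neg_nonpos.2 (by positivity))

theorem enorm_heatSymbol_smul (ν t : ℝ) (ξ : R3) (x : F) :
    ‖heatSymbol ν t ξ • x‖ₑ = ENNReal.ofReal (heatSymbol ν t ξ) * ‖x‖ₑ := by
  rw [enorm_smul, Real.enorm_of_nonneg (by rw [heatSymbol]; positivity)]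

theorem enorm_mild_le (ht : 0 ≤ t) (ξ : R3) :
    ‖mild ν U₀ N t ξ‖ₑ ≤ ENNReal.ofReal (heatSymbol ν t ξ) * ‖U₀ ξ‖ₑ +
      ∫⁻ s in Ioc 0 t, ENNReal.ofReal (heatSymbol ν (t - s) ξ) * ‖N s ξ‖ₑ := by
  simp only [← enorm_heatSymbol_smul]
  rw [mild, intervalIntegral.integral_of_le ht]
  exact (enorm_add_le _ _).trans (add_le_add_right (enorm_integral_le_lintegral_enorm _) _)

theorem enorm_mild_le_add (hν : 0 ≤ ν) (ht : t ∈ Icc 0 T) (ξ : R3) :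
    ‖mild ν U₀ N t ξ‖ₑ ≤ ‖U₀ ξ‖ₑ + ∫⁻ s in Ioc 0 T, ‖N s ξ‖ₑ := by
  have hle {r : ℝ} (hr : 0 ≤ r) (x : F) : ENNReal.ofReal (heatSymbol ν r ξ) * ‖x‖ₑ ≤ ‖x‖ₑ :=
    mul_le_of_le_one_left' (ENNReal.ofReal_le_one.2 (heatSymbol_le_one hν hr ξ))
  refine (enorm_mild_le ht.1 ξ).trans (add_le_add (hle ht.1 _) ?_)
  exact (setLIntegral_mono' measurableSet_Ioc fun s hs => hle (sub_nonneg.2 hs.2) _).trans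
    (lintegral_mono_set (Ioc_subset_Ioc_right ht.2))

theorem intervalIntegrable_heatSymbol_smul (hN : IntegrableOn (N · ξ) (Ioc 0 T)) (r : ℝ)
    (ht : t ∈ Icc 0 T) :
    IntervalIntegrable (fun s => heatSymbol ν (r - s) ξ • N s ξ) volume 0 t := by
  have hNt : IntervalIntegrable (N · ξ) volume 0 t :=
    (intervalIntegrable_iff_integrableOn_Ioc_of_le ht.1).2
      (hN.mono_set (Ioc_subset_Ioc_right ht.2))
  exact hNt.continuousOn_smul (by fun_prop)

theorem mild_sub_mild (hN : IntegrableOn (N · ξ) (Ioc 0 T)) (hM : IntegrableOn (M · ξ) (Ioc 0 T))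
    (ht : t ∈ Icc 0 T) : mild ν U₀ N t ξ - mild ν U₀ M t ξ = mild ν 0 (N - M) t ξ := by
  simp only [mild, Pi.zero_apply, Pi.sub_apply, smul_zero, zero_add, smul_sub]
  rw [intervalIntegral.integral_sub (intervalIntegrable_heatSymbol_smul hN t ht)
    (intervalIntegrable_heatSymbol_smul hM t ht)]
  abel

theorem mild_congr (h : ∀ᵐ s ∂(volume.restrict (Ioc 0 T)), N s = M s) (ht : t ∈ Icc 0 T) :
    mild ν U₀ N t = mild ν U₀ M t := by
  ext1 ξ
  simp only [mild, intervalIntegral.integral_of_le ht.1]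
  congr 1
  refine integral_congr_ae ?_
  filter_upwards [ae_restrict_of_ae_restrict_of_subset (Ioc_subset_Ioc_right ht.2) h] with s hs
  rw [hs]

theorem mild_congr_data (h : U₀ =ᵐ[volume] U₁) : mild ν U₀ N t =ᵐ[volume] mild ν U₁ N t :=
  h.mono fun ξ hξ => by simp only [mild, hξ]

theorem mild_zero_time : mild ν U₀ N 0 = U₀ := by
  ext1 ξ
  simp [mild, heatSymbol]

theorem continuousOn_mild (hN : IntegrableOn (N · ξ) (Ioc 0 T)) :
    ContinuousOn (fun t => mild ν U₀ N t ξ) (Icc 0 T) := by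
  rcases lt_or_ge T 0 with hT | hT
  · simp [Icc_eq_empty hT.not_ge]
  have hfactor (t : ℝ) : mild ν U₀ N t ξ = heatSymbol ν t ξ •
      (U₀ ξ + ∫ s in (0 : ℝ)..t, heatSymbol ν (0 - s) ξ • N s ξ) := by
    rw [mild, smul_add, ← intervalIntegral.integral_smul]
    simp only [smul_smul, ← heatSymbol_add]
    ring_nf
  have hprim : ContinuousOn (fun t => ∫ s in (0 : ℝ)..t, heatSymbol ν (0 - s) ξ • N s ξ)
      (Icc 0 T) := by
    simpa only [uIcc_of_le hT] using intervalIntegral.continuousOn_primitive_interval'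
      (intervalIntegrable_heatSymbol_smul hN 0 (right_mem_Icc.2 hT)) left_mem_uIcc
  simp only [hfactor]
  fun_prop

variable [MeasurableSpace F] [BorelSpace F] [SecondCountableTopology F]

theorem measurable_mild (hU₀ : Measurable U₀) (hN : Measurable (Function.uncurry N)) :
    Measurable (Function.uncurry (mild ν U₀ N)) := by
  have hm : Measurable fun q : (ℝ × R3) × ℝ => heatSymbol ν (q.1.1 - q.2) q.1.2 • N q.2 q.1.2 :=
    (measurable_heatSymbol (by fun_prop) (by fun_prop)).smul
      (hN.comp (measurable_snd.prodMk measurable_fst.snd))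
  have hpos : MeasurableSet {q : (ℝ × R3) × ℝ | q.2 ∈ Ioc 0 q.1.1} :=
    (measurableSet_lt measurable_const measurable_snd).inter
      (measurableSet_le measurable_snd measurable_fst.fst)
  have hneg : MeasurableSet {q : (ℝ × R3) × ℝ | q.2 ∈ Ioc q.1.1 0} :=
    (measurableSet_lt measurable_fst.fst measurable_snd).inter
      (measurableSet_le measurable_snd measurable_const)
  have hpos' := (hm.indicator hpos).stronglyMeasurable.integral_prod_right' (ν := volume)
  have hneg' := (hm.indicator hneg).stronglyMeasurable.integral_prod_right' (ν := volume)
  refine Measurable.add (f := fun p : ℝ × R3 => heatSymbol ν p.1 p.2 • U₀ p.2) (by fun_prop) ?_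
  convert hpos'.measurable.sub hneg'.measurable using 1
  ext1 p
  simp only [intervalIntegral, Pi.sub_apply, ← integral_indicator measurableSet_Ioc]
  rfl

theorem mild_energy (hν : 0 < ν) (hU₀ : Measurable U₀) (hN : Measurable (Function.uncurry N))
    (ht : 0 ≤ t) :
    densityNorm (-1) (mild ν U₀ N t) +
        ENNReal.ofReal ν * ∫⁻ τ in Ioc 0 t, densityNorm 1 (mild ν U₀ N τ) ≤
      densityNorm (-1) U₀ + ∫⁻ s in Ioc 0 t, densityNorm (-1) (N s) := by
  have hM := measurable_mild (ν := ν) hU₀ hN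
  have hMt : Measurable (mild ν U₀ N t) := hM.of_uncurry_left
  rw [lintegral_densityNorm 1 hM, lintegral_densityNorm (-1) hN,
    ← lintegral_const_mul' _ _ ENNReal.ofReal_ne_top, densityNorm, densityNorm,
    ← lintegral_add_left (by fun_prop), ← lintegral_add_left (by fun_prop)]
  refine lintegral_mono_ae ?_
  filter_upwards [Measure.ae_ne volume (0 : R3)] with ξ hξ
  set k := 2 * Real.pi * ‖ξ‖ with hk
  have hkpos : 0 < k := by positivity
  have hweight : ENNReal.ofReal ν * ENNReal.ofReal (k ^ (1 : ℤ)) =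
      ENNReal.ofReal (k ^ (-1 : ℤ)) * ENNReal.ofReal (ν * k ^ 2) := by
    rw [← ENNReal.ofReal_mul hν.le, ← ENNReal.ofReal_mul (by positivity), zpow_neg_one, zpow_one]
    congr 1
    field_simp
  have hNξ : Measurable fun s => ‖N s ξ‖ₑ := hN.of_uncurry_right.enorm
  have hmild {τ : ℝ} (hτ : 0 ≤ τ) := enorm_mild_le (ν := ν) (U₀ := U₀) (N := N) hτ ξ
  simp only [heatSymbol_eq, ← hk] at hmild
  rw [← mul_assoc, hweight, mul_assoc, ← mul_add, ← mul_add,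
    ← scalar_duhamel_identity (a := ν * k ^ 2) (by positivity) ht ‖U₀ ξ‖ₑ hNξ]
  refine mul_le_mul_right (add_le_add (hmild ht) (mul_le_mul_right ?_ _)) _
  exact setLIntegral_mono' measurableSet_Ioc fun τ hτ => hmild hτ.1.le

theorem densityNorm_mild_le (hν : 0 < ν) (hU₀ : Measurable U₀)
    (hN : Measurable (Function.uncurry N)) (ht : t ∈ Icc 0 T) :
    densityNorm (-1) (mild ν U₀ N t) ≤
      densityNorm (-1) U₀ + ∫⁻ s in Ioc 0 T, densityNorm (-1) (N s) :=
  le_self_add.trans <| (mild_energy hν hU₀ hN ht.1).trans <|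
    add_le_add_right (lintegral_mono_set (Ioc_subset_Ioc_right ht.2)) _

theorem lintegral_sq_mild_le (hν : 0 < ν) (hU₀ : Measurable U₀)
    (hN : Measurable (Function.uncurry N)) (hT : 0 ≤ T) :
    ENNReal.ofReal ν * ∫⁻ t in Ioc 0 T, densityNorm 0 (mild ν U₀ N t) ^ 2 ≤
      (densityNorm (-1) U₀ + ∫⁻ s in Ioc 0 T, densityNorm (-1) (N s)) ^ 2 := by
  set K := densityNorm (-1) U₀ + ∫⁻ s in Ioc 0 T, densityNorm (-1) (N s)
  have hM := measurable_mild (ν := ν) hU₀ hN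
  calc ENNReal.ofReal ν * ∫⁻ t in Ioc 0 T, densityNorm 0 (mild ν U₀ N t) ^ 2
      ≤ ENNReal.ofReal ν * ∫⁻ t in Ioc 0 T, K * densityNorm 1 (mild ν U₀ N t) := by
        refine mul_le_mul_right (setLIntegral_mono' measurableSet_Ioc fun t ht => ?_) _
        refine (sq_densityNorm_zero_le hM.of_uncurry_left).trans ?_
        exact mul_le_mul_left (densityNorm_mild_le hν hU₀ hN (Ioc_subset_Icc_self ht)) _
    _ = K * (ENNReal.ofReal ν * ∫⁻ t in Ioc 0 T, densityNorm 1 (mild ν U₀ N t)) := by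
        rw [lintegral_const_mul _ (by fun_prop), mul_left_comm]
    _ ≤ K * K := mul_le_mul_right (le_add_self.trans (mild_energy hν hU₀ hN hT)) _
    _ = K ^ 2 := (sq K).symm

theorem tendsto_densityNorm_mild_sub (hν : 0 ≤ ν) (hU₀ : Measurable U₀)
    (hN : Measurable (Function.uncurry N)) (hU₀' : densityNorm (-1) U₀ ≠ ⊤)
    (hN' : ∫⁻ s in Ioc 0 T, densityNorm (-1) (N s) ≠ ⊤) (ht : t ∈ Icc 0 T) :
    Tendsto (fun τ => densityNorm (-1) (mild ν U₀ N τ - mild ν U₀ N t)) (𝓝[Icc 0 T] t) (𝓝 0) := by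
  have hM (τ : ℝ) : Measurable (mild ν U₀ N τ) := (measurable_mild hU₀ hN).of_uncurry_left
  let w (ξ : R3) : ℝ≥0∞ := ENNReal.ofReal ((2 * Real.pi * ‖ξ‖) ^ (-1 : ℤ))
  have hdom := tendsto_lintegral_filter_of_dominated_convergence (μ := volume)
    (l := 𝓝[Icc 0 T] t) (F := fun τ ξ => w ξ * ‖(mild ν U₀ N τ - mild ν U₀ N t) ξ‖ₑ)
    (f := fun _ => 0) (fun ξ => 2 * (w ξ * ‖U₀ ξ‖ₑ + w ξ * ∫⁻ s in Ioc 0 T, ‖N s ξ‖ₑ))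
    (.of_forall fun τ => (measurable_weight (-1)).mul ((hM τ).sub (hM t)).enorm) ?_ ?_ ?_
  · rwa [lintegral_zero] at hdom
  · filter_upwards [self_mem_nhdsWithin] with τ hτ
    refine .of_forall fun ξ => ?_
    rw [← mul_add, mul_left_comm, two_mul]
    exact mul_le_mul_right (enorm_sub_le.trans
      (add_le_add (enorm_mild_le_add hν hτ ξ) (enorm_mild_le_add hν ht ξ))) _
  · rw [lintegral_const_mul' _ _ ENNReal.ofNat_ne_top, lintegral_add_left (by fun_prop),
      ← lintegral_densityNorm (-1) hN]
    exact ENNReal.mul_ne_top ENNReal.ofNat_ne_top (ENNReal.add_ne_top.2 ⟨hU₀', hN'⟩)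
  · filter_upwards [ae_integrableOn_of_lintegral_densityNorm hN hN'] with ξ hξ
    have hlim : Tendsto (fun τ => ‖(mild ν U₀ N τ - mild ν U₀ N t) ξ‖ₑ) (𝓝[Icc 0 T] t) (𝓝 0) := by
      have hcont : ContinuousWithinAt (mild ν U₀ N · ξ) (Icc 0 T) t := continuousOn_mild hξ t ht
      simpa only [Pi.sub_apply, sub_self, enorm_zero] using
        (hcont.tendsto.sub_const (mild ν U₀ N t ξ)).enorm
    simpa only [mul_zero] using
      ENNReal.Tendsto.const_mul (a := w ξ) hlim (Or.inr ENNReal.ofReal_ne_top)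

end Mild

theorem add_sq_le_two_mul_add_two_mul (a b : ℝ≥0∞) : (a + b) ^ 2 ≤ 2 * a ^ 2 + 2 * b ^ 2 := by
  have h := ENNReal.rpow_add_le_mul_rpow_add_rpow a b (p := 2) one_le_two
  norm_num at h
  simpa [mul_add] using h

theorem four_mul_four_inv_mul (x : ℝ≥0∞) : 4 * (4⁻¹ * x) = x := by
  rw [← mul_assoc, ENNReal.mul_inv_cancel (by simp) (by simp), one_mul]

theorem sq_tsum_le (q : ℕ → ℝ≥0∞) : (∑' m, q m) ^ 2 ≤ 2 * ∑' m, 2 ^ m * q m ^ 2 := by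
  have h := sq_lintegral_le_lintegral_mul_lintegral (μ := Measure.count)
    (f := fun m : ℕ => (2⁻¹ : ℝ≥0∞) ^ m) (g := fun m => 2 ^ m * q m ^ 2) (h := q)
    (by fun_prop) (by fun_prop) (.of_forall fun m => by
      rw [← mul_assoc, ← mul_pow, ENNReal.inv_mul_cancel (by simp) (by simp), one_pow, one_mul])
  simpa [lintegral_count, ENNReal.tsum_geometric] using h

theorem lintegral_sq_tsum_le {α : Type*} [MeasurableSpace α] {μ : Measure α} {q : ℕ → α → ℝ≥0∞}
    (hq : ∀ m, Measurable (q m)) {C : ℝ≥0∞} (h : ∀ m, ∫⁻ t, q m t ^ 2 ∂μ ≤ C * 4⁻¹ ^ m) :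
    ∫⁻ t, (∑' m, q m t) ^ 2 ∂μ ≤ 4 * C := by
  have four_inv : (4⁻¹ : ℝ≥0∞) = 2⁻¹ * 2⁻¹ := by
    rw [← ENNReal.mul_inv (by simp) (by simp)]; norm_num
  calc ∫⁻ t, (∑' m, q m t) ^ 2 ∂μ
      ≤ ∫⁻ t, 2 * ∑' m, 2 ^ m * q m t ^ 2 ∂μ := lintegral_mono fun t => sq_tsum_le _
    _ = 2 * ∑' m, 2 ^ m * ∫⁻ t, q m t ^ 2 ∂μ := by
        rw [lintegral_const_mul' _ _ (by simp), lintegral_tsum (by fun_prop)]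
        simp only [lintegral_const_mul' _ _ (ENNReal.pow_ne_top ENNReal.ofNat_ne_top)]
    _ ≤ 2 * ∑' m, C * 2⁻¹ ^ m := by
        gcongr 2 * ∑' m, ?_ with m
        refine (mul_le_mul_right (h m) _).trans_eq ?_
        rw [mul_left_comm, ← mul_pow, four_inv, ← mul_assoc,
          ENNReal.mul_inv_cancel (by simp) (by simp), one_mul]
    _ = 4 * C := by
        rw [ENNReal.tsum_mul_left, ENNReal.tsum_geometric, ENNReal.one_sub_inv_two, inv_inv]
        ring

theorem eq_zero_of_forall_le_geometric {x C : ℝ≥0∞} (hC : C ≠ ⊤) (h : ∀ n : ℕ, x ≤ C * 4⁻¹ ^ n) :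
    x = 0 := by
  have hlim : Tendsto (fun n : ℕ => C * (4⁻¹ : ℝ≥0∞) ^ n) atTop (𝓝 (C * 0)) :=
    ENNReal.Tendsto.const_mul (ENNReal.tendsto_pow_atTop_nhds_zero_of_lt_one (by
      rw [ENNReal.inv_lt_one]; norm_num)) (Or.inr hC)
  rw [mul_zero] at hlim
  exact nonpos_iff_eq_zero.1 (ge_of_tendsto' hlim h)

theorem densityNorm_sub_limUnder_le {E F : Type*} [NormedAddCommGroup E] [MeasureSpace E]
    [NormedAddCommGroup F] [CompleteSpace F] [MeasurableSpace F] [BorelSpace F]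
    [SecondCountableTopology F] {g : ℕ → E → F} (hg : ∀ n, Measurable (g n))
    (h : ∑' m, densityNorm 0 (g m - g (m + 1)) ≠ ⊤) (n : ℕ) :
    densityNorm 0 (g n - fun ξ => limUnder atTop (g · ξ)) ≤
      ∑' m, densityNorm 0 (g (n + m) - g (n + m + 1)) := by
  have hm (m : ℕ) : Measurable fun ξ => ‖(g m - g (m + 1)) ξ‖ₑ :=
    ((hg m).sub (hg (m + 1))).enorm
  simp only [densityNorm_zero_left] at h ⊢
  rw [← lintegral_tsum fun m => (hm m).aemeasurable] at h
  rw [← lintegral_tsum fun m => (hm _).aemeasurable]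
  refine lintegral_mono_ae ?_
  filter_upwards [ae_lt_top (Measurable.tsum hm) h] with ξ hξ
  have hstep (m : ℕ) : edist (g m ξ) (g (m + 1) ξ) ≤ ‖(g m - g (m + 1)) ξ‖ₑ :=
    (edist_eq_enorm_sub _ _).le
  have hlim := (cauchySeq_of_edist_le_of_tsum_ne_top _ hstep hξ.ne).tendsto_limUnder
  simpa [edist_eq_enorm_sub] using edist_le_tsum_of_edist_le_of_tendsto _ hstep hlim n

theorem measurable_uncurry_piecewise {α E F : Type*} [MeasurableSpace α] [MeasurableSpace E]
    [MeasurableSpace F] {s : Set α} [DecidablePred (· ∈ s)] (hs : MeasurableSet s)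
    {U V : α → E → F} (hU : Measurable (Function.uncurry U))
    (hV : Measurable (Function.uncurry V)) :
    Measurable (Function.uncurry (s.piecewise U V)) := by
  classical
  have h : Measurable ((Prod.fst ⁻¹' s).piecewise (Function.uncurry U) (Function.uncurry V)) :=
    hU.piecewise (hs.preimage measurable_fst) hV
  convert h using 1
  ext p
  by_cases hp : p.1 ∈ s <;> simp [Function.uncurry_def, hp]

theorem measurable_iterate {α E F : Type*} [MeasurableSpace α] [MeasurableSpace E]
    [MeasurableSpace F] [Zero F] {Φ : (α → E → F) → α → E → F}
    (hΦ : ∀ V, Measurable (Function.uncurry V) → Measurable (Function.uncurry (Φ V))) (n : ℕ) :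
    Measurable (Function.uncurry (Φ^[n] 0)) := by
  induction n with
  | zero => exact measurable_const
  | succ n ih => rw [Function.iterate_succ_apply']; exact hΦ _ ih

theorem lintegral_Ioc_add {f : ℝ → ℝ≥0∞} {a b c : ℝ} (hab : a ≤ b) (hbc : b ≤ c) :
    ∫⁻ t in Ioc a c, f t = (∫⁻ t in Ioc a b, f t) + ∫⁻ t in Ioc b c, f t := by
  rw [← Ioc_union_Ioc_eq_Ioc hab hbc,
    lintegral_union measurableSet_Ioc (Ioc_disjoint_Ioc_of_le le_rfl)]

theorem exists_pos_setLIntegral_Ioc_le {S : Set ℝ} {f : ℝ → ℝ≥0∞} (h : ∫⁻ t in S, f t ≠ ⊤)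
    {ε : ℝ≥0∞} (hε : ε ≠ 0) :
    ∃ d > 0, ∀ a b, Ioc a b ⊆ S → b - a ≤ d → ∫⁻ t in Ioc a b, f t ≤ ε := by
  obtain ⟨δ, hδ, hsmall⟩ := exists_pos_setLIntegral_lt_of_measure_lt h hε
  obtain ⟨d, hd, hdδ⟩ := ENNReal.lt_iff_exists_nnreal_btwn.1 hδ
  refine ⟨d, by simpa using hd, fun a b hS hab => ?_⟩
  have hvol : (volume.restrict S) (Ioc a b) < δ :=
    calc (volume.restrict S) (Ioc a b) ≤ ENNReal.ofReal (b - a) := by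
          rw [← Real.volume_Ioc]; exact Measure.restrict_apply_le _ _
      _ ≤ d := ENNReal.ofReal_le_of_le_toReal hab
      _ < δ := hdδ
  have hint := hsmall _ hvol
  rw [Measure.restrict_restrict measurableSet_Ioc, inter_eq_left.2 hS] at hint
  exact hint.le

theorem interval_induction {P : ℝ → Prop} {T d : ℝ} (hT : 0 ≤ T) (hd : 0 < d) (zero : P 0)
    (step : ∀ a b, 0 ≤ a → a ≤ b → b ≤ T → b - a ≤ d → P a → P b) : P T := by
  have grid (n : ℕ) : P (min T (n * d)) := by
    induction n with
    | zero => simpa [hT] using zero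
    | succ n ih =>
      push_cast
      refine step _ _ (le_min hT (by positivity)) (min_le_min le_rfl (by linarith))
        (min_le_left _ _) ?_ ih
      rcases le_total T (n * d) with h | h
      · rw [min_eq_left h, min_eq_left (by linarith), sub_self]
        exact hd.le
      · rw [min_eq_right h]
        linarith [min_le_right T ((n + 1) * d)]
  obtain ⟨n, hn⟩ := exists_nat_ge (T / d)
  simpa [(div_le_iff₀ hd).1 hn] using grid n

section SqL2Norm

variable {α E F : Type*} [MeasureSpace α] [NormedAddCommGroup E] [MeasureSpace E]
  [NormedAddCommGroup F] {S S' : Set α} {U V W : α → E → F}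

/-- The square of the norm of `L²(S; χ⁰)`, for curves given by the Fourier transforms of their
values. -/
def sqL2Norm (S : Set α) (U : α → E → F) : ℝ≥0∞ := ∫⁻ t in S, densityNorm 0 (U t) ^ 2

theorem sqL2Norm_zero : sqL2Norm S (0 : α → E → F) = 0 := by
  simp [sqL2Norm, densityNorm_zero_right]

theorem sqL2Norm_mono (h : S ⊆ S') : sqL2Norm S U ≤ sqL2Norm S' U :=
  lintegral_mono_set h

theorem sqL2Norm_sub_comm : sqL2Norm S (U - V) = sqL2Norm S (V - U) :=
  lintegral_congr fun t => by rw [Pi.sub_apply, Pi.sub_apply, densityNorm_sub_comm]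

theorem sqL2Norm_congr (h : ∀ᵐ t ∂(volume.restrict S), U t =ᵐ[volume] V t) :
    sqL2Norm S U = sqL2Norm S V :=
  lintegral_congr_ae (h.mono fun t ht => by simp only [densityNorm_congr ht])

theorem sqL2Norm_Ioc_add {U : ℝ → E → F} {a b c : ℝ} (hab : a ≤ b) (hbc : b ≤ c) :
    sqL2Norm (Ioc a c) U = sqL2Norm (Ioc a b) U + sqL2Norm (Ioc b c) U :=
  lintegral_Ioc_add hab hbc

variable [BorelSpace E] [SFinite (volume : Measure E)] [MeasurableSpace F] [BorelSpace F]

theorem ae_densityNorm_ne_top (hU : Measurable (Function.uncurry U)) (h : sqL2Norm S U ≠ ⊤) :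
    ∀ᵐ t ∂(volume.restrict S), densityNorm 0 (U t) ≠ ⊤ := by
  filter_upwards [ae_lt_top (by fun_prop) h] with t ht
  exact fun htop => by simp [htop] at ht

theorem lintegral_sq_add_le (hU : Measurable (Function.uncurry U)) :
    ∫⁻ t in S, (densityNorm 0 (U t) + densityNorm 0 (V t)) ^ 2 ≤
      2 * sqL2Norm S U + 2 * sqL2Norm S V := by
  refine (lintegral_mono fun t => add_sq_le_two_mul_add_two_mul _ _).trans_eq ?_
  rw [lintegral_add_left (by fun_prop), lintegral_const_mul' _ _ (by simp),
    lintegral_const_mul' _ _ (by simp)]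
  rfl

variable [SecondCountableTopology F]

theorem ae_eq_of_sqL2Norm_sub_eq_zero (hU : Measurable (Function.uncurry U))
    (hV : Measurable (Function.uncurry V)) (h : sqL2Norm S (U - V) = 0) :
    ∀ᵐ t ∂(volume.restrict S), U t =ᵐ[volume] V t := by
  have hUV : Measurable (Function.uncurry (U - V)) := hU.sub hV
  rw [sqL2Norm, lintegral_eq_zero_iff (by fun_prop)] at h
  filter_upwards [h] with t ht
  exact ae_eq_of_densityNorm_zero_sub_eq_zero hU.of_uncurry_left hV.of_uncurry_left
    (by simpa using ht)

theorem sqL2Norm_sub_le (hU : Measurable (Function.uncurry U))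
    (hV : Measurable (Function.uncurry V)) :
    sqL2Norm S (U - W) ≤ 2 * sqL2Norm S (U - V) + 2 * sqL2Norm S (V - W) := by
  have hUV : Measurable (Function.uncurry (U - V)) := hU.sub hV
  refine le_trans (lintegral_mono fun t => ?_) (lintegral_sq_add_le hUV)
  gcongr
  exact densityNorm_sub_le hU.of_uncurry_left hV.of_uncurry_left

theorem sqL2Norm_le_sub_add (hU : Measurable (Function.uncurry U))
    (hV : Measurable (Function.uncurry V)) :
    sqL2Norm S U ≤ 2 * sqL2Norm S (U - V) + 2 * sqL2Norm S V := by
  simpa using sqL2Norm_sub_le (W := 0) hU hV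

theorem sqL2Norm_sub_le_add (hU : Measurable (Function.uncurry U)) :
    sqL2Norm S (U - V) ≤ 2 * sqL2Norm S U + 2 * sqL2Norm S V := by
  have h := sqL2Norm_sub_le (S := S) (V := 0) (W := V) hU measurable_const
  rwa [sub_zero, sqL2Norm_sub_comm (U := 0), sub_zero] at h

theorem exists_limit_of_sqL2Norm_sub_le [CompleteSpace F] {V : ℕ → α → E → F}
    (hV : ∀ n, Measurable (Function.uncurry (V n))) {C : ℝ≥0∞} (hC : C ≠ ⊤)
    (h : ∀ n, sqL2Norm S (V n - V (n + 1)) ≤ C * 4⁻¹ ^ n) :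
    ∃ W : α → E → F, Measurable (Function.uncurry W) ∧
      ∀ n, sqL2Norm S (V n - W) ≤ 4 * (C * 4⁻¹ ^ n) := by
  let q (n : ℕ) (t : α) : ℝ≥0∞ := densityNorm 0 ((V n - V (n + 1)) t)
  have hq (n : ℕ) : Measurable (q n) := measurable_densityNorm 0 ((hV n).sub (hV (n + 1)))
  refine ⟨fun t ξ => limUnder atTop fun n => V n t ξ, ?_, fun n => ?_⟩
  · exact (StronglyMeasurable.limUnder (l := atTop)
      fun n => (hV n).stronglyMeasurable).measurable
  have hsum : ∀ᵐ t ∂(volume.restrict S), (∑' m, q m t) ^ 2 < ⊤ :=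
    ae_lt_top ((Measurable.tsum hq).pow_const 2)
      (ne_top_of_le_ne_top (ENNReal.mul_ne_top (by simp) hC) (lintegral_sq_tsum_le hq h))
  calc sqL2Norm S (V n - fun t ξ => limUnder atTop fun n => V n t ξ)
      ≤ ∫⁻ t in S, (∑' m, q (n + m) t) ^ 2 := by
        refine lintegral_mono_ae (hsum.mono fun t ht => ?_)
        gcongr
        exact densityNorm_sub_limUnder_le (fun m => (hV m).of_uncurry_left)
          (fun htop => by simp [q, htop] at ht) n
    _ ≤ 4 * (C * 4⁻¹ ^ n) := lintegral_sq_tsum_le (fun m => hq (n + m)) fun m =>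
        (h (n + m)).trans_eq (by rw [pow_add, mul_assoc])

section FixedPoint

/-- `Φ` maps the ball of squared radius `R` of `L²(S; χ⁰)` to itself and contracts squared distances
there by `1/4`; the self-map property is expressed through the size of `Φ 0`. -/
structure IsSqL2Contraction (S : Set α) (R : ℝ≥0∞) (Φ : (α → E → F) → α → E → F) : Prop where
  measurable : ∀ V, Measurable (Function.uncurry V) → Measurable (Function.uncurry (Φ V))
  map_zero_le : sqL2Norm S (Φ 0) ≤ 4⁻¹ * R
  map_sub_le : ∀ V W, Measurable (Function.uncurry V) → Measurable (Function.uncurry W) →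
    sqL2Norm S V ≤ R → sqL2Norm S W ≤ R → sqL2Norm S (Φ V - Φ W) ≤ 4⁻¹ * sqL2Norm S (V - W)

variable {Φ : (α → E → F) → α → E → F} {R : ℝ≥0∞}

theorem IsSqL2Contraction.sqL2Norm_iterate_le (hΦ : IsSqL2Contraction S R Φ) (n : ℕ) :
    sqL2Norm S (Φ^[n] 0) ≤ R := by
  have h₀R : sqL2Norm S (0 : α → E → F) ≤ R := sqL2Norm_zero.trans_le zero_le
  induction n with
  | zero => exact h₀R
  | succ n ih =>
    have hm := measurable_iterate hΦ.measurable n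
    calc sqL2Norm S (Φ^[n + 1] 0)
        ≤ 2 * sqL2Norm S (Φ (Φ^[n] 0) - Φ 0) + 2 * sqL2Norm S (Φ 0) := by
          rw [Function.iterate_succ_apply']
          exact sqL2Norm_le_sub_add (hΦ.measurable _ hm) (hΦ.measurable _ measurable_const)
      _ ≤ 2 * (4⁻¹ * R) + 2 * (4⁻¹ * R) := by
          gcongr
          · refine (hΦ.map_sub_le _ _ hm measurable_const ih h₀R).trans ?_
            rw [sub_zero]
            gcongr
          · exact hΦ.map_zero_le
      _ = 4 * (4⁻¹ * R) := by ring
      _ = R := four_mul_four_inv_mul R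

theorem IsSqL2Contraction.sqL2Norm_iterate_sub_le (hΦ : IsSqL2Contraction S R Φ) (n : ℕ) :
    sqL2Norm S (Φ^[n] 0 - Φ^[n + 1] 0) ≤ 4⁻¹ * R * 4⁻¹ ^ n := by
  induction n with
  | zero => rw [sqL2Norm_sub_comm]; simpa using hΦ.map_zero_le
  | succ n ih =>
    rw [Function.iterate_succ_apply' Φ n, Function.iterate_succ_apply' Φ (n + 1), pow_succ',
      mul_left_comm]
    have hm := measurable_iterate hΦ.measurable
    exact (hΦ.map_sub_le _ _ (hm n) (hm (n + 1)) (hΦ.sqL2Norm_iterate_le n)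
      (hΦ.sqL2Norm_iterate_le (n + 1))).trans (by gcongr)

theorem IsSqL2Contraction.exists_fixedPoint [CompleteSpace F] (hΦ : IsSqL2Contraction S R Φ)
    (hR : R ≠ ⊤) :
    ∃ W, Measurable (Function.uncurry W) ∧ sqL2Norm S W ≤ R ∧
      ∀ᵐ t ∂(volume.restrict S), W t =ᵐ[volume] Φ W t := by
  have hm := measurable_iterate hΦ.measurable
  have hle := hΦ.sqL2Norm_iterate_le
  obtain ⟨W, hW, hlim⟩ := exists_limit_of_sqL2Norm_sub_le hm (by finiteness)
    hΦ.sqL2Norm_iterate_sub_le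
  simp only [mul_assoc, four_mul_four_inv_mul] at hlim
  have hW_le : sqL2Norm S W ≤ R := by
    have h := hlim 0
    rw [sqL2Norm_sub_comm] at h
    simpa using h
  refine ⟨W, hW, hW_le, ae_eq_of_sqL2Norm_sub_eq_zero hW (hΦ.measurable _ hW) ?_⟩
  refine eq_zero_of_forall_le_geometric hR fun n => ?_
  calc sqL2Norm S (W - Φ W)
      ≤ 2 * sqL2Norm S (Φ^[n + 1] 0 - W) + 2 * sqL2Norm S (Φ (Φ^[n] 0) - Φ W) := by
        rw [sqL2Norm_sub_comm (U := Φ^[n + 1] 0), ← Function.iterate_succ_apply' Φ n]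
        exact sqL2Norm_sub_le hW (hm (n + 1))
    _ ≤ 2 * (R * 4⁻¹ ^ (n + 1)) + 2 * (4⁻¹ * (R * 4⁻¹ ^ n)) := by
        gcongr
        · exact hlim (n + 1)
        · exact (hΦ.map_sub_le _ _ (hm n) hW (hle n) hW_le).trans (by gcongr; exact hlim n)
    _ = 4 * (4⁻¹ * (R * 4⁻¹ ^ n)) := by ring
    _ = R * 4⁻¹ ^ n := four_mul_four_inv_mul _

end FixedPoint

end SqL2Norm

section DuhamelMap

variable {ν a b t T : ℝ} {U₀ : R3 → C3} {U V : ℝ → R3 → C3} {S : Set ℝ}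

/-- The map `u ↦ exp (tνΔ) u₀ + ∫₀ᵗ exp ((t-s)νΔ) 𝒫 div (u ⊗ u)(s) ds` on the Fourier side; its
fixed points are the mild solutions. -/
def duhamelMap (ν : ℝ) (U₀ : R3 → C3) (U : ℝ → R3 → C3) : ℝ → R3 → C3 :=
  mild ν U₀ fun s => nonlinearHat (U s)

theorem measurable_duhamelMap (hU₀ : Measurable U₀) (hU : Measurable (Function.uncurry U)) :
    Measurable (Function.uncurry (duhamelMap ν U₀ U)) :=
  measurable_mild hU₀ (measurable_nonlinearHat hU)

theorem duhamelMap_congr (h : ∀ᵐ s ∂(volume.restrict (Ioc 0 T)), U s =ᵐ[volume] V s)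
    (ht : t ∈ Icc 0 T) : duhamelMap ν U₀ U t = duhamelMap ν U₀ V t :=
  mild_congr (h.mono fun _ hs => nonlinearHat_congr hs) ht

theorem lintegral_densityNorm_nonlinearHat_le (hU : Measurable (Function.uncurry U)) :
    ∫⁻ s in S, densityNorm (-1) (nonlinearHat (U s)) ≤ sqL2Norm S U :=
  lintegral_mono fun _ => densityNorm_nonlinearHat_le hU.of_uncurry_left

theorem sqL2Norm_duhamelMap_le (hν : 0 < ν) (hU₀ : Measurable U₀)
    (hU : Measurable (Function.uncurry U)) (hT : 0 ≤ T) :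
    ENNReal.ofReal ν * sqL2Norm (Ioc 0 T) (duhamelMap ν U₀ U) ≤
      (densityNorm (-1) U₀ + sqL2Norm (Ioc 0 T) U) ^ 2 :=
  (lintegral_sq_mild_le hν hU₀ (measurable_nonlinearHat hU) hT).trans <| by
    gcongr
    exact lintegral_densityNorm_nonlinearHat_le hU

theorem sq_lintegral_densityNorm_nonlinearHat_sub_le (hU : Measurable (Function.uncurry U))
    (hV : Measurable (Function.uncurry V)) (hUS : sqL2Norm S U ≠ ⊤) (hVS : sqL2Norm S V ≠ ⊤) :
    (∫⁻ s in S, densityNorm (-1) (nonlinearHat (U s) - nonlinearHat (V s))) ^ 2 ≤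
      (2 * sqL2Norm S U + 2 * sqL2Norm S V) * sqL2Norm S (U - V) := by
  have hUV : Measurable (Function.uncurry (U - V)) := hU.sub hV
  refine (sq_lintegral_le_lintegral_mul_lintegral
    (f := fun s => (densityNorm 0 (U s) + densityNorm 0 (V s)) ^ 2)
    (g := fun s => densityNorm 0 ((U - V) s) ^ 2) (by fun_prop)
    ((measurable_densityNorm 0 hUV).pow_const 2).aemeasurable ?_).trans
    (mul_le_mul_left (lintegral_sq_add_le hU) _)
  filter_upwards [ae_densityNorm_ne_top hU hUS, ae_densityNorm_ne_top hV hVS] with s hUs hVs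
  rw [← mul_pow]
  gcongr
  exact densityNorm_nonlinearHat_sub_le hU.of_uncurry_left hV.of_uncurry_left hUs hVs

theorem sqL2Norm_duhamelMap_sub_le_sq_lintegral (hν : 0 < ν) (hU : Measurable (Function.uncurry U))
    (hV : Measurable (Function.uncurry V)) (hT : 0 ≤ T) (hUT : sqL2Norm (Ioc 0 T) U ≠ ⊤)
    (hVT : sqL2Norm (Ioc 0 T) V ≠ ⊤) :
    ENNReal.ofReal ν * sqL2Norm (Ioc 0 T) (duhamelMap ν U₀ U - duhamelMap ν U₀ V) ≤
      (∫⁻ s in Ioc 0 T, densityNorm (-1) (nonlinearHat (U s) - nonlinearHat (V s))) ^ 2 := by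
  have hNU := measurable_nonlinearHat hU
  have hNV := measurable_nonlinearHat hV
  have hdiff : ∀ᵐ t ∂(volume.restrict (Ioc 0 T)), (duhamelMap ν U₀ U - duhamelMap ν U₀ V) t
      =ᵐ[volume] mild ν 0 (fun s => nonlinearHat (U s) - nonlinearHat (V s)) t := by
    filter_upwards [ae_restrict_mem measurableSet_Ioc] with t ht
    filter_upwards [ae_integrableOn_of_lintegral_densityNorm hNU
        (ne_top_of_le_ne_top hUT (lintegral_densityNorm_nonlinearHat_le hU)),
      ae_integrableOn_of_lintegral_densityNorm hNV
        (ne_top_of_le_ne_top hVT (lintegral_densityNorm_nonlinearHat_le hV))] with ξ hUξ hVξ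
    exact mild_sub_mild hUξ hVξ (Ioc_subset_Icc_self ht)
  rw [sqL2Norm_congr hdiff]
  simpa only [densityNorm_zero_right, zero_add, sqL2Norm] using
    lintegral_sq_mild_le (N := fun s => nonlinearHat (U s) - nonlinearHat (V s)) hν measurable_zero
      (hNU.sub hNV) hT

theorem sqL2Norm_duhamelMap_sub_le (hν : 0 < ν) (hU : Measurable (Function.uncurry U))
    (hV : Measurable (Function.uncurry V)) (ha : 0 ≤ a) (hab : a ≤ b)
    (hUb : sqL2Norm (Ioc 0 b) U ≠ ⊤) (hVb : sqL2Norm (Ioc 0 b) V ≠ ⊤)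
    (hUV : ∀ᵐ t ∂(volume.restrict (Ioc 0 a)), U t =ᵐ[volume] V t) :
    ENNReal.ofReal ν * sqL2Norm (Ioc a b) (duhamelMap ν U₀ U - duhamelMap ν U₀ V) ≤
      (2 * sqL2Norm (Ioc a b) U + 2 * sqL2Norm (Ioc a b) V) * sqL2Norm (Ioc a b) (U - V) := by
  have hsub := Ioc_subset_Ioc_left (b := b) ha
  have hpast : ∫⁻ s in Ioc 0 a, densityNorm (-1) (nonlinearHat (U s) - nonlinearHat (V s)) = 0 :=
    lintegral_eq_zero_of_ae_eq_zero <| hUV.mono fun s hs =>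
      densityNorm_sub_eq_zero (nonlinearHat_congr hs).eventuallyEq
  calc ENNReal.ofReal ν * sqL2Norm (Ioc a b) (duhamelMap ν U₀ U - duhamelMap ν U₀ V)
      ≤ ENNReal.ofReal ν * sqL2Norm (Ioc 0 b) (duhamelMap ν U₀ U - duhamelMap ν U₀ V) := by
        gcongr
        exact sqL2Norm_mono hsub
    _ ≤ (∫⁻ s in Ioc 0 b, densityNorm (-1) (nonlinearHat (U s) - nonlinearHat (V s))) ^ 2 :=
        sqL2Norm_duhamelMap_sub_le_sq_lintegral hν hU hV (ha.trans hab) hUb hVb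
    _ = (∫⁻ s in Ioc a b, densityNorm (-1) (nonlinearHat (U s) - nonlinearHat (V s))) ^ 2 := by
        rw [lintegral_Ioc_add ha hab, hpast, zero_add]
    _ ≤ _ := sq_lintegral_densityNorm_nonlinearHat_sub_le hU hV
        (ne_top_of_le_ne_top hUb (sqL2Norm_mono hsub))
        (ne_top_of_le_ne_top hVb (sqL2Norm_mono hsub))

theorem sqL2Norm_duhamelMap_sub_le_of_small (hν : 0 < ν) (hU : Measurable (Function.uncurry U))
    (hV : Measurable (Function.uncurry V)) (ha : 0 ≤ a) (hab : a ≤ b)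
    (hUa : sqL2Norm (Ioc 0 a) U ≠ ⊤)
    (hUV : ∀ᵐ t ∂(volume.restrict (Ioc 0 a)), U t =ᵐ[volume] V t)
    (hUb : sqL2Norm (Ioc a b) U ≤ ENNReal.ofReal ν / 16)
    (hVb : sqL2Norm (Ioc a b) V ≤ ENNReal.ofReal ν / 16) :
    sqL2Norm (Ioc a b) (duhamelMap ν U₀ U - duhamelMap ν U₀ V) ≤
      4⁻¹ * sqL2Norm (Ioc a b) (U - V) := by
  have hν₀ : ENNReal.ofReal ν ≠ 0 := (ENNReal.ofReal_pos.2 hν).ne'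
  have hsmall : 2 * sqL2Norm (Ioc a b) U + 2 * sqL2Norm (Ioc a b) V ≤ ENNReal.ofReal ν * 4⁻¹ :=
    calc 2 * sqL2Norm (Ioc a b) U + 2 * sqL2Norm (Ioc a b) V
        ≤ 2 * (ENNReal.ofReal ν / 16) + 2 * (ENNReal.ofReal ν / 16) := by gcongr
      _ = ENNReal.ofReal ν * (4 * 16⁻¹) := by rw [div_eq_mul_inv]; ring
      _ = ENNReal.ofReal ν * 4⁻¹ := by
          rw [show (16 : ℝ≥0∞) = 4 * 4 by norm_num, ENNReal.mul_inv (by simp) (by simp),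
            four_mul_four_inv_mul]
  rw [← ENNReal.mul_le_mul_iff_right hν₀ ENNReal.ofReal_ne_top, ← mul_assoc]
  refine (sqL2Norm_duhamelMap_sub_le hν hU hV ha hab ?_ ?_ hUV).trans (by gcongr)
  · rw [sqL2Norm_Ioc_add ha hab]
    exact ENNReal.add_ne_top.2 ⟨hUa, ne_top_of_le_ne_top (by finiteness) hUb⟩
  · rw [sqL2Norm_Ioc_add ha hab, ← sqL2Norm_congr hUV]
    exact ENNReal.add_ne_top.2 ⟨hUa, ne_top_of_le_ne_top (by finiteness) hVb⟩

theorem exists_sqL2Norm_duhamelMap_Ioc_le (hν : 0 < ν) (hU₀ : Measurable U₀)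
    (h₀ : densityNorm (-1) U₀ ≠ ⊤) (hU : Measurable (Function.uncurry U)) (ha : 0 ≤ a)
    (haT : a < T) (hUT : sqL2Norm (Ioc 0 T) U ≠ ⊤) {ε : ℝ≥0∞} (hε : ε ≠ 0) :
    ∃ b > a, sqL2Norm (Ioc a b) (duhamelMap ν U₀ U) ≤ ε := by
  have hfin : sqL2Norm (Ioc 0 T) (duhamelMap ν U₀ U) ≠ ⊤ := fun htop => by
    have hle := sqL2Norm_duhamelMap_le hν hU₀ hU (ha.trans haT.le)
    rw [htop, ENNReal.mul_top (ENNReal.ofReal_pos.2 hν).ne', top_le_iff] at hle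
    exact ENNReal.pow_ne_top (by finiteness) hle
  obtain ⟨d, hd, hsmall⟩ := exists_pos_setLIntegral_Ioc_le hfin hε
  exact ⟨min (a + d) T, lt_min (by linarith) haT, hsmall _ _
    (Ioc_subset_Ioc ha (min_le_right _ _)) (by linarith [min_le_left (a + d) T])⟩

end DuhamelMap

theorem piecewise_Iic_ae_eq_left {E F : Type*} [MeasureSpace E] (U V : ℝ → E → F) {a c : ℝ} :
    ∀ᵐ t ∂(volume.restrict (Ioc c a)), (Iic a).piecewise U V t =ᵐ[volume] U t :=
  (ae_restrict_mem measurableSet_Ioc).mono fun _ ht =>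
    .of_eq <| piecewise_eq_of_mem _ _ _ ht.2

theorem piecewise_Iic_ae_eq_right {E F : Type*} [MeasureSpace E] (U V : ℝ → E → F) {a b : ℝ} :
    ∀ᵐ t ∂(volume.restrict (Ioc a b)), (Iic a).piecewise U V t =ᵐ[volume] V t :=
  (ae_restrict_mem measurableSet_Ioc).mono fun _ ht =>
    .of_eq <| piecewise_eq_of_notMem _ _ _ (notMem_Iic.2 ht.1)

/-- `U` is the Fourier transform of a mild solution in `L²([0,T]; χ⁰)` whose data have Fourier
transform `U₀`; the divergence-free condition is not included. -/
structure IsFourierSolution (ν : ℝ) (U₀ : R3 → C3) (T : ℝ) (U : ℝ → R3 → C3) : Prop where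
  measurable : Measurable (Function.uncurry U)
  sqL2Norm_ne_top : sqL2Norm (Ioc 0 T) U ≠ ⊤
  ae_eq_duhamelMap : ∀ᵐ t ∂(volume.restrict (Ioc 0 T)), U t =ᵐ[volume] duhamelMap ν U₀ U t

namespace IsFourierSolution

variable {ν a b T T' : ℝ} {U₀ : R3 → C3} {U V : ℝ → R3 → C3}

theorem mono (h : IsFourierSolution ν U₀ T U) (hT : T' ≤ T) : IsFourierSolution ν U₀ T' U where
  measurable := h.measurable
  sqL2Norm_ne_top := ne_top_of_le_ne_top h.sqL2Norm_ne_top (sqL2Norm_mono (Ioc_subset_Ioc_right hT))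
  ae_eq_duhamelMap :=
    ae_restrict_of_ae_restrict_of_subset (Ioc_subset_Ioc_right hT) h.ae_eq_duhamelMap

theorem congr (h : IsFourierSolution ν U₀ T U) (hV : Measurable (Function.uncurry V))
    (hUV : ∀ᵐ t ∂(volume.restrict (Ioc 0 T)), U t =ᵐ[volume] V t) :
    IsFourierSolution ν U₀ T V where
  measurable := hV
  sqL2Norm_ne_top := sqL2Norm_congr hUV ▸ h.sqL2Norm_ne_top
  ae_eq_duhamelMap := by
    filter_upwards [hUV, h.ae_eq_duhamelMap, ae_restrict_mem measurableSet_Ioc] with t hUVt hUt ht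
    rw [← duhamelMap_congr hUV (Ioc_subset_Icc_self ht)]
    exact hUVt.symm.trans hUt

theorem ae_eq (hν : 0 < ν) (hT : 0 ≤ T) (hU : IsFourierSolution ν U₀ T U)
    (hV : IsFourierSolution ν U₀ T V) :
    ∀ᵐ t ∂(volume.restrict (Ioc 0 T)), U t =ᵐ[volume] V t := by
  have hε : ENNReal.ofReal ν / 16 ≠ 0 := (ENNReal.div_pos (by simpa) (by simp)).ne'
  obtain ⟨d, hd, hUd⟩ := exists_pos_setLIntegral_Ioc_le hU.sqL2Norm_ne_top hε
  obtain ⟨d', hd', hVd⟩ := exists_pos_setLIntegral_Ioc_le hV.sqL2Norm_ne_top hε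
  refine ae_eq_of_sqL2Norm_sub_eq_zero hU.measurable hV.measurable ?_
  refine interval_induction (P := fun b => sqL2Norm (Ioc 0 b) (U - V) = 0) hT (lt_min hd hd')
    (by simp [sqL2Norm]) fun a b ha hab hbT hba hzero => ?_
  have hsub := Ioc_subset_Ioc ha hbT
  have hUb := hUd a b hsub (hba.trans (min_le_left _ _))
  have hVb := hVd a b hsub (hba.trans (min_le_right _ _))
  have hcontr : sqL2Norm (Ioc a b) (U - V) ≤ 4⁻¹ * sqL2Norm (Ioc a b) (U - V) :=
    calc sqL2Norm (Ioc a b) (U - V)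
        = sqL2Norm (Ioc a b) (duhamelMap ν U₀ U - duhamelMap ν U₀ V) := by
          refine sqL2Norm_congr ?_
          filter_upwards [ae_restrict_of_ae_restrict_of_subset hsub hU.ae_eq_duhamelMap,
            ae_restrict_of_ae_restrict_of_subset hsub hV.ae_eq_duhamelMap] with t hUt hVt
          exact hUt.sub hVt
      _ ≤ 4⁻¹ * sqL2Norm (Ioc a b) (U - V) :=
          sqL2Norm_duhamelMap_sub_le_of_small hν hU.measurable hV.measurable ha hab
            (hU.mono (hab.trans hbT)).sqL2Norm_ne_top
            (ae_eq_of_sqL2Norm_sub_eq_zero hU.measurable hV.measurable hzero) hUb hVb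
  have hfin : sqL2Norm (Ioc a b) (U - V) ≠ ⊤ := by
    have hU_top := ne_top_of_le_ne_top (by finiteness) hUb
    have hV_top := ne_top_of_le_ne_top (by finiteness) hVb
    exact ne_top_of_le_ne_top (by finiteness) (sqL2Norm_sub_le_add hU.measurable)
  rw [sqL2Norm_Ioc_add ha hab, hzero, zero_add]
  by_contra hpos
  refine hcontr.not_gt ?_
  simpa using ENNReal.mul_lt_mul_left hpos hfin (show (4⁻¹ : ℝ≥0∞) < 1 by simp)

theorem piecewise (ha : 0 ≤ a) (hab : a ≤ b) (hU : IsFourierSolution ν U₀ a U)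
    (hV : Measurable (Function.uncurry V)) (hVb : sqL2Norm (Ioc a b) V ≠ ⊤)
    (hfix : ∀ᵐ t ∂(volume.restrict (Ioc a b)),
      V t =ᵐ[volume] duhamelMap ν U₀ ((Iic a).piecewise U V) t) :
    IsFourierSolution ν U₀ b ((Iic a).piecewise U V) where
  measurable := measurable_uncurry_piecewise measurableSet_Iic hU.measurable hV
  sqL2Norm_ne_top := by
    rw [sqL2Norm_Ioc_add ha hab, sqL2Norm_congr (piecewise_Iic_ae_eq_left U V),
      sqL2Norm_congr (piecewise_Iic_ae_eq_right U V)]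
    exact ENNReal.add_ne_top.2 ⟨hU.sqL2Norm_ne_top, hVb⟩
  ae_eq_duhamelMap := by
    rw [← Ioc_union_Ioc_eq_Ioc ha hab, ae_restrict_union_iff]
    constructor
    · filter_upwards [piecewise_Iic_ae_eq_left U V, hU.ae_eq_duhamelMap,
        ae_restrict_mem measurableSet_Ioc] with t ht hUt hta
      rw [duhamelMap_congr (piecewise_Iic_ae_eq_left U V) (Ioc_subset_Icc_self hta)]
      exact ht.trans hUt
    · filter_upwards [piecewise_Iic_ae_eq_right U V, hfix] with t ht hVt
      exact ht.trans hVt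

theorem exists_extension_of_small (hν : 0 < ν) (hU₀ : Measurable U₀) (ha : 0 ≤ a) (hab : a ≤ b)
    (hU : IsFourierSolution ν U₀ a U)
    (hsmall : sqL2Norm (Ioc a b) (duhamelMap ν U₀ ((Iic a).piecewise U 0)) ≤
      4⁻¹ * (ENNReal.ofReal ν / 16)) :
    ∃ V, IsFourierSolution ν U₀ b V := by
  have hm (V : ℝ → R3 → C3) (hV : Measurable (Function.uncurry V)) :
      Measurable (Function.uncurry ((Iic a).piecewise U V)) :=
    measurable_uncurry_piecewise measurableSet_Iic hU.measurable hV
  have hleft (V : ℝ → R3 → C3) := piecewise_Iic_ae_eq_left (c := 0) (a := a) U V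
  have hright (V : ℝ → R3 → C3) := piecewise_Iic_ae_eq_right (a := a) (b := b) U V
  have hcontr : IsSqL2Contraction (Ioc a b) (ENNReal.ofReal ν / 16)
      fun V => duhamelMap ν U₀ ((Iic a).piecewise U V) := by
    refine ⟨fun V hV => measurable_duhamelMap hU₀ (hm V hV), hsmall,
      fun V V' hV hV' hV_le hV'_le => ?_⟩
    rw [← sqL2Norm_congr (hright V)] at hV_le
    rw [← sqL2Norm_congr (hright V')] at hV'_le
    refine (sqL2Norm_duhamelMap_sub_le_of_small hν (hm V hV) (hm V' hV') ha hab ?_ ?_ hV_le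
      hV'_le).trans_eq ?_
    · exact (sqL2Norm_congr (hleft V)).trans_ne hU.sqL2Norm_ne_top
    · filter_upwards [hleft V, hleft V'] with t ht ht'
      exact ht.trans ht'.symm
    · congr 1
      refine sqL2Norm_congr ?_
      filter_upwards [hright V, hright V'] with t ht ht'
      exact ht.sub ht'
  obtain ⟨W, hW, hW_le, hfix⟩ := hcontr.exists_fixedPoint (by finiteness)
  exact ⟨_, hU.piecewise ha hab hW (ne_top_of_le_ne_top (by finiteness) hW_le) hfix⟩

theorem exists_extension (hν : 0 < ν) (hU₀ : Measurable U₀) (h₀ : densityNorm (-1) U₀ ≠ ⊤)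
    (ha : 0 ≤ a) (hU : IsFourierSolution ν U₀ a U) :
    ∃ b, a < b ∧ ∃ V, IsFourierSolution ν U₀ b V := by
  have hfin : sqL2Norm (Ioc 0 (a + 1)) ((Iic a).piecewise U 0) ≠ ⊤ := by
    rw [sqL2Norm_Ioc_add ha (by linarith), sqL2Norm_congr (piecewise_Iic_ae_eq_left U 0),
      sqL2Norm_congr (piecewise_Iic_ae_eq_right U 0), sqL2Norm_zero, add_zero]
    exact hU.sqL2Norm_ne_top
  have hε : 4⁻¹ * (ENNReal.ofReal ν / 16) ≠ 0 := by
    have := ENNReal.ofReal_pos.2 hν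
    simp [this.ne', ENNReal.div_eq_zero_iff]
  obtain ⟨b, hab, hsmall⟩ := exists_sqL2Norm_duhamelMap_Ioc_le hν hU₀ h₀
    (measurable_uncurry_piecewise measurableSet_Iic hU.measurable measurable_const) ha
    (lt_add_one a) hfin hε
  exact ⟨b, hab, exists_extension_of_small hν hU₀ ha hab.le hU hsmall⟩

end IsFourierSolution

theorem exists_measurable_ae_eq_of_compatible {α E F : Type*} [MeasurableSpace α]
    [MeasurableSpace E] [MeasurableSpace F] {μ : Measure α} {ρ : Measure E} {A : ℕ → Set α}
    (hA : ∀ n, MeasurableSet (A n)) {V : ℕ → α → E → F}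
    (hV : ∀ n, Measurable (Function.uncurry (V n)))
    (hcompat : ∀ m n, ∀ᵐ t ∂(μ.restrict (A m ∩ A n)), V m t =ᵐ[ρ] V n t) :
    ∃ U : α → E → F, Measurable (Function.uncurry U) ∧
      ∀ n, ∀ᵐ t ∂(μ.restrict (A n)), U t =ᵐ[ρ] V n t := by
  have hdisj : Pairwise fun i j => EqOn (Function.uncurry (V i)) (Function.uncurry (V j))
      (Prod.fst ⁻¹' disjointed A i ∩ Prod.fst ⁻¹' disjointed A j) := fun i j hij p hp =>
    (disjoint_left.1 (disjoint_disjointed A hij) hp.1 hp.2).elim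
  obtain ⟨f, hf, hfV⟩ := exists_measurable_piecewise (fun n => Prod.fst ⁻¹' disjointed A n)
    (fun n => measurable_fst (.disjointed hA n)) (fun n => Function.uncurry (V n)) hV hdisj
  refine ⟨Function.curry f, hf, fun n => ?_⟩
  have hn : ∀ᵐ t ∂(μ.restrict (A n)), ∀ m, t ∈ A m → V m t =ᵐ[ρ] V n t := by
    refine ae_all_iff.2 fun m => ?_
    rw [← ae_restrict_iff' (hA m), Measure.restrict_restrict (hA m)]
    exact hcompat m n
  filter_upwards [hn, ae_restrict_mem (hA n)] with t ht htn
  obtain ⟨m, hm⟩ := mem_iUnion.1 (iUnion_disjointed (f := A) ▸ mem_iUnion_of_mem n htn)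
  have heq : Function.curry f t = V m t :=
    funext fun ξ => hfV m (show (t, ξ) ∈ Prod.fst ⁻¹' disjointed A m from hm)
  rw [heq]
  exact ht m (disjointed_subset A m hm)

theorem continuousOn_densityNorm {E F : Type*} [NormedAddCommGroup E] [MeasureSpace E]
    [BorelSpace E] [NormedAddCommGroup F] [MeasurableSpace F] [BorelSpace F]
    [SecondCountableTopology F] {k : ℤ} {V : ℝ → E → F} (hV : ∀ t, Measurable (V t)) {S : Set ℝ}
    (h : ∀ t ∈ S, Tendsto (fun τ => densityNorm k (V τ - V t)) (𝓝[S] t) (𝓝 0)) :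
    ContinuousOn (fun t => densityNorm k (V t)) S := fun t ht => by
  have hlower := ENNReal.Tendsto.sub (tendsto_const_nhds (x := densityNorm k (V t))) (h t ht)
    (.inr ENNReal.zero_ne_top)
  have hupper := (h t ht).add (tendsto_const_nhds (x := densityNorm k (V t)))
  rw [tsub_zero] at hlower
  rw [zero_add] at hupper
  refine tendsto_of_tendsto_of_tendsto_of_le_of_le hlower hupper (fun τ => ?_) fun τ =>
    densityNorm_le_sub_add (hV τ) (hV t)
  rw [densityNorm_sub_comm, tsub_le_iff_left]
  exact densityNorm_le_sub_add (hV t) (hV τ)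

theorem lintegral_Ioc_le_of_forall_lt {f : ℝ → ℝ≥0∞} (hf : Measurable f) {a b : ℝ} {C : ℝ≥0∞}
    (h : ∀ t ∈ Ioo a b, ∫⁻ s in Ioc a t, f s ≤ C) : ∫⁻ s in Ioc a b, f s ≤ C := by
  rcases le_or_gt b a with hba | hab
  · simp [Ioc_eq_empty_of_le hba]
  rw [← restrict_Ioo_eq_restrict_Ioc]
  have hcover : AECover (volume.restrict (Ioo a b)) (𝓝[<] b) fun t => Ioc a t :=
    aecover_Ioo_of_Ioc tendsto_const_nhds (tendsto_id.mono_left nhdsWithin_le_nhds)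
  refine le_of_tendsto (hcover.lintegral_tendsto_of_countably_generated hf.aemeasurable) ?_
  filter_upwards [Ioo_mem_nhdsLT hab] with t ht
  exact (lintegral_mono' (Measure.restrict_mono_measure Measure.restrict_le_self _) le_rfl).trans
    (h t ht)

/-- The maximal time of existence on the Fourier side, without the divergence-free condition. -/
def fourierMaxTime (ν : ℝ) (U₀ : R3 → C3) : ℝ≥0∞ :=
  ⨆ (T : ℝ) (_ : 0 < T ∧ ∃ U, IsFourierSolution ν U₀ T U), ENNReal.ofReal T

section FourierMaxTime

variable {ν t T : ℝ} {U₀ : R3 → C3} {U : ℝ → R3 → C3}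

theorem lt_fourierMaxTime_iff {x : ℝ≥0∞} :
    x < fourierMaxTime ν U₀ ↔
      ∃ T : ℝ, (0 < T ∧ ∃ U, IsFourierSolution ν U₀ T U) ∧ x < ENNReal.ofReal T := by
  simp only [fourierMaxTime, lt_iSup_iff, exists_prop]

theorem isFourierSolution_zero (ν : ℝ) (U₀ : R3 → C3) : IsFourierSolution ν U₀ 0 0 where
  measurable := measurable_const
  sqL2Norm_ne_top := by simp [sqL2Norm]
  ae_eq_duhamelMap := by simp

theorem IsFourierSolution.lt_fourierMaxTime (hν : 0 < ν) (hU₀ : Measurable U₀)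
    (h₀ : densityNorm (-1) U₀ ≠ ⊤) (hT : 0 ≤ T) (hU : IsFourierSolution ν U₀ T U) :
    ENNReal.ofReal T < fourierMaxTime ν U₀ := by
  obtain ⟨b, hTb, hb⟩ := hU.exists_extension hν hU₀ h₀ hT
  have hb₀ : 0 < b := hT.trans_lt hTb
  exact lt_fourierMaxTime_iff.2 ⟨b, ⟨hb₀, hb⟩, (ENNReal.ofReal_lt_ofReal_iff hb₀).2 hTb⟩

theorem fourierMaxTime_pos (hν : 0 < ν) (hU₀ : Measurable U₀) (h₀ : densityNorm (-1) U₀ ≠ ⊤) :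
    0 < fourierMaxTime ν U₀ := by
  simpa using (isFourierSolution_zero ν U₀).lt_fourierMaxTime hν hU₀ h₀ le_rfl

theorem exists_glued_solution (hν : 0 < ν) (hU₀ : Measurable U₀) (h₀ : densityNorm (-1) U₀ ≠ ⊤) :
    ∃ U : ℝ → R3 → C3, Measurable (Function.uncurry U) ∧
      ∀ T, ENNReal.ofReal T < fourierMaxTime ν U₀ → IsFourierSolution ν U₀ T U := by
  obtain ⟨x, -, hx_lt, hx⟩ := exists_seq_strictMono_tendsto' (fourierMaxTime_pos hν hU₀ h₀)
  choose τ hτ hxτ using fun n => lt_fourierMaxTime_iff.1 (hx_lt n).2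
  choose hτ₀ V hV using hτ
  obtain ⟨U, hU, hUV⟩ := exists_measurable_ae_eq_of_compatible (μ := volume) (ρ := volume)
    (fun n => measurableSet_Ioc (a := 0) (b := τ n)) (fun n => (hV n).measurable) fun m n => by
      rw [Ioc_inter_Ioc, max_self]
      exact ((hV m).mono (min_le_left _ _)).ae_eq hν (le_min (hτ₀ m).le (hτ₀ n).le)
        ((hV n).mono (min_le_right _ _))
  refine ⟨U, hU, fun T hT => ?_⟩
  obtain ⟨n, hn⟩ := (hx.eventually (lt_mem_nhds hT)).exists
  have hTτ : T ≤ τ n := ((ENNReal.ofReal_lt_ofReal_iff (hτ₀ n)).1 (hn.trans (hxτ n))).le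
  exact ((hV n).congr hU ((hUV n).mono fun _ ht => ht.symm)).mono hTτ

end FourierMaxTime

/-- `V` is the Fourier transform of the maximal solution with data in `χ⁻¹` having Fourier
transform `U₀`. It satisfies the Duhamel formula at every time, not only at almost every one. -/
structure IsMaximalFourierSolution (ν : ℝ) (U₀ : R3 → C3) (V : ℝ → R3 → C3) : Prop where
  viscosity_pos : 0 < ν
  measurable_data : Measurable U₀
  data_ne_top : densityNorm (-1) U₀ ≠ ⊤
  measurable : Measurable (Function.uncurry V)
  isFourierSolution : ∀ T, ENNReal.ofReal T < fourierMaxTime ν U₀ → IsFourierSolution ν U₀ T V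
  eq_duhamelMap : ∀ t, 0 ≤ t → ENNReal.ofReal t < fourierMaxTime ν U₀ → V t = duhamelMap ν U₀ V t

theorem exists_isMaximalFourierSolution {ν : ℝ} (hν : 0 < ν) {U₀ : R3 → C3} (hU₀ : Measurable U₀)
    (h₀ : densityNorm (-1) U₀ ≠ ⊤) : ∃ V, IsMaximalFourierSolution ν U₀ V := by
  obtain ⟨U, hU, hsol⟩ := exists_glued_solution hν hU₀ h₀
  have hM := measurable_duhamelMap (ν := ν) hU₀ hU
  exact ⟨duhamelMap ν U₀ U, hν, hU₀, h₀, hM,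
    fun T hT => (hsol T hT).congr hM (hsol T hT).ae_eq_duhamelMap,
    fun t ht htmax => duhamelMap_congr (hsol t htmax).ae_eq_duhamelMap ⟨ht, le_rfl⟩⟩

namespace IsMaximalFourierSolution

variable {ν t T : ℝ} {U₀ : R3 → C3} {V W : ℝ → R3 → C3}

theorem lt_fourierMaxTime (h : IsMaximalFourierSolution ν U₀ V) (hT : 0 ≤ T)
    (hW : IsFourierSolution ν U₀ T W) : ENNReal.ofReal T < fourierMaxTime ν U₀ :=
  hW.lt_fourierMaxTime h.viscosity_pos h.measurable_data h.data_ne_top hT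

theorem pos (h : IsMaximalFourierSolution ν U₀ V) : 0 < fourierMaxTime ν U₀ :=
  fourierMaxTime_pos h.viscosity_pos h.measurable_data h.data_ne_top

theorem initial (h : IsMaximalFourierSolution ν U₀ V) : V 0 = U₀ := by
  rw [h.eq_duhamelMap 0 le_rfl (by simpa using h.pos), duhamelMap, mild_zero_time]

theorem ae_eq (h : IsMaximalFourierSolution ν U₀ V) (hT : 0 ≤ T)
    (hW : IsFourierSolution ν U₀ T W) :
    ∀ᵐ t ∂(volume.restrict (Ioc 0 T)), W t =ᵐ[volume] V t :=
  hW.ae_eq h.viscosity_pos hT (h.isFourierSolution T (h.lt_fourierMaxTime hT hW))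

theorem lintegral_densityNorm_nonlinearHat_ne_top (h : IsMaximalFourierSolution ν U₀ V)
    (hTmax : ENNReal.ofReal T < fourierMaxTime ν U₀) :
    ∫⁻ s in Ioc 0 T, densityNorm (-1) (nonlinearHat (V s)) ≠ ⊤ :=
  ne_top_of_le_ne_top (h.isFourierSolution T hTmax).sqL2Norm_ne_top
    (lintegral_densityNorm_nonlinearHat_le h.measurable)

theorem energy (h : IsMaximalFourierSolution ν U₀ V) (hT : 0 ≤ T)
    (hTmax : ENNReal.ofReal T < fourierMaxTime ν U₀) :
    densityNorm (-1) (V T) + ENNReal.ofReal ν * ∫⁻ t in Ioc 0 T, densityNorm 1 (V t) ≤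
      densityNorm (-1) U₀ + ∫⁻ s in Ioc 0 T, densityNorm (-1) (nonlinearHat (V s)) := by
  have hint : ∫⁻ t in Ioc 0 T, densityNorm 1 (V t) =
      ∫⁻ t in Ioc 0 T, densityNorm 1 (duhamelMap ν U₀ V t) :=
    setLIntegral_congr_fun measurableSet_Ioc fun t ht => congrArg (densityNorm 1) <|
      h.eq_duhamelMap t ht.1.le ((ENNReal.ofReal_le_ofReal ht.2).trans_lt hTmax)
  rw [hint, h.eq_duhamelMap T hT hTmax]
  exact mild_energy h.viscosity_pos h.measurable_data (measurable_nonlinearHat h.measurable) hT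

theorem densityNorm_le (h : IsMaximalFourierSolution ν U₀ V) (ht : t ∈ Icc 0 T)
    (hTmax : ENNReal.ofReal T < fourierMaxTime ν U₀) :
    densityNorm (-1) (V t) ≤
      densityNorm (-1) U₀ + ∫⁻ s in Ioc 0 T, densityNorm (-1) (nonlinearHat (V s)) := by
  rw [h.eq_duhamelMap t ht.1 ((ENNReal.ofReal_le_ofReal ht.2).trans_lt hTmax)]
  exact densityNorm_mild_le h.viscosity_pos h.measurable_data
    (measurable_nonlinearHat h.measurable) ht

theorem densityNorm_ne_top (h : IsMaximalFourierSolution ν U₀ V) (ht : 0 ≤ t)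
    (htmax : ENNReal.ofReal t < fourierMaxTime ν U₀) : densityNorm (-1) (V t) ≠ ⊤ :=
  ne_top_of_le_ne_top
    (ENNReal.add_ne_top.2 ⟨h.data_ne_top, h.lintegral_densityNorm_nonlinearHat_ne_top htmax⟩)
    (h.densityNorm_le ⟨ht, le_rfl⟩ htmax)

theorem lintegral_densityNorm_one_ne_top (h : IsMaximalFourierSolution ν U₀ V) (hT : 0 ≤ T)
    (hTmax : ENNReal.ofReal T < fourierMaxTime ν U₀) :
    ∫⁻ t in Ioc 0 T, densityNorm 1 (V t) ≠ ⊤ := fun htop => by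
  have henergy := h.energy hT hTmax
  rw [htop, ENNReal.mul_top (ENNReal.ofReal_pos.2 h.viscosity_pos).ne', add_top, top_le_iff]
    at henergy
  exact ENNReal.add_ne_top.2
    ⟨h.data_ne_top, h.lintegral_densityNorm_nonlinearHat_ne_top hTmax⟩ henergy

theorem tendsto_densityNorm_sub (h : IsMaximalFourierSolution ν U₀ V)
    (hTmax : ENNReal.ofReal T < fourierMaxTime ν U₀) (ht : t ∈ Icc 0 T) :
    Tendsto (fun τ => densityNorm (-1) (V τ - V t)) (𝓝[Icc 0 T] t) (𝓝 0) := by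
  have hV (τ : ℝ) (hτ : τ ∈ Icc 0 T) : V τ = duhamelMap ν U₀ V τ :=
    h.eq_duhamelMap τ hτ.1 ((ENNReal.ofReal_le_ofReal hτ.2).trans_lt hTmax)
  refine (tendsto_densityNorm_mild_sub h.viscosity_pos.le h.measurable_data
    (measurable_nonlinearHat h.measurable) h.data_ne_top
    (h.lintegral_densityNorm_nonlinearHat_ne_top hTmax) ht).congr' ?_
  filter_upwards [self_mem_nhdsWithin] with τ hτ
  rw [hV τ hτ, hV t ht, duhamelMap]

theorem blowup (h : IsMaximalFourierSolution ν U₀ V) (hmax : fourierMaxTime ν U₀ ≠ ⊤) :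
    sqL2Norm (Ioc 0 (fourierMaxTime ν U₀).toReal) V = ⊤ := by
  by_contra hfin
  have hsol : IsFourierSolution ν U₀ (fourierMaxTime ν U₀).toReal V := by
    refine ⟨h.measurable, hfin, ?_⟩
    rw [← restrict_Ioo_eq_restrict_Ioc]
    filter_upwards [ae_restrict_mem measurableSet_Ioo] with t ht
    rw [← h.eq_duhamelMap t ht.1.le ((ENNReal.ofReal_lt_iff_lt_toReal ht.1.le hmax).2 ht.2)]
  simpa [ENNReal.ofReal_toReal hmax] using h.lt_fourierMaxTime ENNReal.toReal_nonneg hsol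

theorem sqL2Norm_le_mul_lintegral (h : IsMaximalFourierSolution ν U₀ V) {M : ℝ≥0∞}
    (hM : ∀ t ∈ Ioo 0 T, densityNorm (-1) (V t) ≤ M) :
    sqL2Norm (Ioc 0 T) V ≤ M * ∫⁻ t in Ioc 0 T, densityNorm 1 (V t) := by
  rw [sqL2Norm, ← lintegral_const_mul _ (measurable_densityNorm 1 h.measurable),
    ← restrict_Ioo_eq_restrict_Ioc]
  refine setLIntegral_mono' measurableSet_Ioo fun t ht => ?_
  exact (sq_densityNorm_zero_le h.measurable.of_uncurry_left).trans (mul_le_mul_left (hM t ht) _)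

theorem energy_of_densityNorm_le (h : IsMaximalFourierSolution ν U₀ V) (hT : 0 ≤ T)
    (hTmax : ENNReal.ofReal T < fourierMaxTime ν U₀) {M : ℝ≥0∞} (hMν : M ≤ ENNReal.ofReal ν)
    (hM : ∀ t ∈ Ioo 0 T, densityNorm (-1) (V t) ≤ M) :
    densityNorm (-1) (V T) + (ENNReal.ofReal ν - M) * ∫⁻ t in Ioc 0 T, densityNorm 1 (V t) ≤
      densityNorm (-1) U₀ := by
  have hM_top : M ≠ ⊤ := ne_top_of_le_ne_top ENNReal.ofReal_ne_top hMν
  have hfin := h.lintegral_densityNorm_one_ne_top hT hTmax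
  refine (ENNReal.add_le_add_iff_right (ENNReal.mul_ne_top hM_top hfin)).1 ?_
  rw [add_assoc, ← add_mul, tsub_add_cancel_of_le hMν]
  exact (h.energy hT hTmax).trans (add_le_add_right
    ((lintegral_densityNorm_nonlinearHat_le h.measurable).trans (h.sqL2Norm_le_mul_lintegral hM)) _)

-- At the first time at which the norm reaches `ν`, the energy estimate with `M = ν` would bound
-- the norm by that of the data.
theorem densityNorm_lt_of_small_data (h : IsMaximalFourierSolution ν U₀ V)
    (hsmall : densityNorm (-1) U₀ < ENNReal.ofReal ν)
    (hTmax : ENNReal.ofReal T < fourierMaxTime ν U₀) (ht : t ∈ Icc 0 T) :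
    densityNorm (-1) (V t) < ENNReal.ofReal ν := by
  by_contra! hge
  have hclosed : IsClosed (Icc 0 T ∩ {t | ENNReal.ofReal ν ≤ densityNorm (-1) (V t)}) :=
    (continuousOn_densityNorm (fun _ => h.measurable.of_uncurry_left)
      fun _ ht => h.tendsto_densityNorm_sub hTmax ht).preimage_isClosed_of_isClosed isClosed_Icc
      isClosed_Ici
  obtain ⟨t₁, ⟨ht₁, hge₁⟩, hleast⟩ :=
    (isCompact_Icc.of_isClosed_subset hclosed inter_subset_left).exists_isLeast ⟨t, ht, hge⟩
  have hbefore : ∀ r ∈ Ioo 0 t₁, densityNorm (-1) (V r) ≤ ENNReal.ofReal ν := fun r hr => by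
    by_contra! hgt
    exact (hleast ⟨⟨hr.1.le, hr.2.le.trans ht₁.2⟩, hgt.le⟩).not_gt hr.2
  have henergy := h.energy_of_densityNorm_le ht₁.1
    ((ENNReal.ofReal_le_ofReal ht₁.2).trans_lt hTmax) le_rfl hbefore
  rw [tsub_self, zero_mul, add_zero] at henergy
  exact (henergy.trans_lt hsmall).not_ge hge₁

theorem densityNorm_le_data (h : IsMaximalFourierSolution ν U₀ V)
    (hsmall : densityNorm (-1) U₀ < ENNReal.ofReal ν) (ht : 0 ≤ t)
    (htmax : ENNReal.ofReal t < fourierMaxTime ν U₀) :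
    densityNorm (-1) (V t) ≤ densityNorm (-1) U₀ := by
  simpa using h.energy_of_densityNorm_le ht htmax le_rfl fun r hr =>
    (h.densityNorm_lt_of_small_data hsmall htmax (Ioo_subset_Icc_self hr)).le

theorem small_data_energy (h : IsMaximalFourierSolution ν U₀ V)
    (hsmall : densityNorm (-1) U₀ < ENNReal.ofReal ν) (hT : 0 ≤ T)
    (hTmax : ENNReal.ofReal T < fourierMaxTime ν U₀) :
    densityNorm (-1) (V T) +
        (ENNReal.ofReal ν - densityNorm (-1) U₀) * ∫⁻ t in Ioc 0 T, densityNorm 1 (V t) ≤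
      densityNorm (-1) U₀ :=
  h.energy_of_densityNorm_le hT hTmax hsmall.le fun _ ht =>
    h.densityNorm_le_data hsmall ht.1.le ((ENNReal.ofReal_le_ofReal ht.2.le).trans_lt hTmax)

theorem sqL2Norm_le_of_small_data (h : IsMaximalFourierSolution ν U₀ V)
    (hsmall : densityNorm (-1) U₀ < ENNReal.ofReal ν) (hT : 0 ≤ T)
    (hTmax : ENNReal.ofReal T < fourierMaxTime ν U₀) :
    sqL2Norm (Ioc 0 T) V ≤ densityNorm (-1) U₀ *
      (densityNorm (-1) U₀ / (ENNReal.ofReal ν - densityNorm (-1) U₀)) := by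
  have hint : ∫⁻ t in Ioc 0 T, densityNorm 1 (V t) ≤
      densityNorm (-1) U₀ / (ENNReal.ofReal ν - densityNorm (-1) U₀) := by
    rw [ENNReal.le_div_iff_mul_le (.inl (tsub_pos_of_lt hsmall).ne')
      (.inl (ENNReal.sub_ne_top ENNReal.ofReal_ne_top)), mul_comm]
    exact le_add_self.trans (h.small_data_energy hsmall hT hTmax)
  refine (h.sqL2Norm_le_mul_lintegral fun t ht => ?_).trans (mul_le_mul_right hint _)
  exact h.densityNorm_le_data hsmall ht.1.le ((ENNReal.ofReal_le_ofReal ht.2.le).trans_lt hTmax)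

theorem fourierMaxTime_eq_top_of_small_data (h : IsMaximalFourierSolution ν U₀ V)
    (hsmall : densityNorm (-1) U₀ < ENNReal.ofReal ν) : fourierMaxTime ν U₀ = ⊤ := by
  by_contra hmax
  have hbound := lintegral_Ioc_le_of_forall_lt
    ((measurable_densityNorm 0 h.measurable).pow_const 2) fun t ht =>
      h.sqL2Norm_le_of_small_data hsmall ht.1.le
        ((ENNReal.ofReal_lt_iff_lt_toReal ht.1.le hmax).2 ht.2)
  refine ENNReal.mul_ne_top h.data_ne_top
    (ENNReal.div_ne_top h.data_ne_top (tsub_pos_of_lt hsmall).ne') (top_le_iff.1 ?_)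
  exact (h.blowup hmax).symm.trans_le hbound

end IsMaximalFourierSolution

section Duhamel

variable {ν t T : ℝ} {ξ : R3} {U₀ : R3 → C3} {N U : ℝ → R3 → C3}

theorem inner_mild_eq_zero {a : C3} (hN : IntegrableOn (N · ξ) (Ioc 0 T)) (ht : t ∈ Icc 0 T)
    (h₀ : inner ℂ a (U₀ ξ) = 0) (h : ∀ s, inner ℂ a (N s ξ) = 0) :
    inner ℂ a (mild ν U₀ N t ξ) = 0 := by
  have hint := (innerSL ℂ a).intervalIntegral_comp_comm
    (intervalIntegrable_heatSymbol_smul (ν := ν) hN t ht)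
  simp only [innerSL_apply_apply] at hint
  rw [mild, inner_add_right, ← hint]
  simp [inner_smul_right_eq_smul, h₀, h]

theorem conjReflect_mild (ν : ℝ) (U₀ : R3 → C3) (N : ℝ → R3 → C3) (t : ℝ) :
    conjReflect (mild ν U₀ N t) = mild ν (conjReflect U₀) (fun s => conjReflect (N s)) t := by
  have hcomm (μ : Measure ℝ) (φ : ℝ → C3) : conjC3 (∫ s, φ s ∂μ) = ∫ s, conjC3 (φ s) ∂μ :=
    (conjC3.toLinearIsometry.integral_comp_comm φ).symm
  have heven (r : ℝ) (ξ : R3) : heatSymbol ν r (-ξ) = heatSymbol ν r ξ := by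
    rw [heatSymbol, heatSymbol, norm_neg]
  ext1 ξ
  simp only [conjReflect, mild, intervalIntegral, map_add, map_sub, map_smul, hcomm, heven]

theorem conjReflect_duhamelMap (ν : ℝ) (U₀ : R3 → C3) (U : ℝ → R3 → C3) (t : ℝ) :
    conjReflect (duhamelMap ν U₀ U t) =
      duhamelMap ν (conjReflect U₀) (fun s => conjReflect (U s)) t := by
  simp only [duhamelMap, conjReflect_mild, nonlinearHat_conjReflect]

theorem IsFourierSolution.conjReflect (hU : IsFourierSolution ν U₀ T U)
    (h₀ : conjReflect U₀ =ᵐ[volume] U₀) :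
    IsFourierSolution ν U₀ T fun t => ChiNS.conjReflect (U t) where
  measurable := conjC3.continuous.measurable.comp
    (hU.measurable.comp (measurable_fst.prodMk measurable_snd.neg))
  sqL2Norm_ne_top := by
    simpa only [sqL2Norm, densityNorm_conjReflect] using hU.sqL2Norm_ne_top
  ae_eq_duhamelMap := by
    filter_upwards [hU.ae_eq_duhamelMap] with t ht
    refine (conjReflect_congr ht).trans ?_
    rw [conjReflect_duhamelMap]
    exact mild_congr_data h₀

end Duhamel

theorem eLpNorm_densityNorm_zero_lt_top_iff {S : Set ℝ} {U : ℝ → R3 → C3} :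
    eLpNorm (fun t => densityNorm 0 (U t)) 2 (volume.restrict S) < ⊤ ↔ sqL2Norm S U ≠ ⊤ := by
  rw [eLpNorm_lt_top_iff_lintegral_rpow_enorm_lt_top (by simp) (by simp), sqL2Norm,
    lt_top_iff_ne_top]
  simp

theorem IsSolution.exists_isFourierSolution {ν T : ℝ} {u₀ : Field3} {v : ℝ → Field3}
    {U₀ : R3 → C3} (hv : IsSolution ν u₀ T v) (h₀ : HasFourierDensity u₀ U₀) :
    ∃ W, IsFourierSolution ν U₀ T W ∧
      ∀ᵐ t ∂(volume.restrict (Ioc 0 T)), HasFourierDensity (v t) (W t) := by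
  obtain ⟨U₁, U, h₁, ⟨hm, hvU⟩, hU⟩ := hv.duhamel
  have hL2 := hv.memL2.2
  rw [← restrict_Ioc_eq_restrict_Icc] at hm hvU hU hL2
  let W : ℝ → R3 → C3 := Function.curry (hm.mk (Function.uncurry U))
  have hUW : ∀ᵐ t ∂(volume.restrict (Ioc 0 T)), U t =ᵐ[volume] W t :=
    Measure.ae_ae_of_ae_prod hm.ae_eq_mk
  have hvW : ∀ᵐ t ∂(volume.restrict (Ioc 0 T)), HasFourierDensity (v t) (W t) := by
    filter_upwards [hvU, hUW] with t hvt hUt using hvt.congr hUt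
  refine ⟨W, ⟨hm.stronglyMeasurable_mk.measurable, ?_, ?_⟩, hvW⟩
  · rwa [eLpNorm_congr_ae (hvW.mono fun t ht => ht.chiNorm_eq 0),
      eLpNorm_densityNorm_zero_lt_top_iff] at hL2
  · filter_upwards [hUW, hU, ae_restrict_mem measurableSet_Ioc] with t hUt hmild ht
    rw [← duhamelMap_congr hUW (Ioc_subset_Icc_self ht)]
    have hmild : U t =ᵐ[volume] duhamelMap ν U₁ U t := hmild
    exact hUt.symm.trans (hmild.trans (mild_congr_data (h₁.ae_eq h₀)))

open Classical in
/-- The field whose Fourier transform is the function `g`; the junk value is `0` if `g` is not the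
transform of a tempered distribution. -/
def toField (g : R3 → C3) : Field3 :=
  if h : ∃ f, HasFourierDensity f g then h.choose else 0

theorem hasFourierDensity_toField {g : R3 → C3} (hm : AEStronglyMeasurable g)
    (hg : densityNorm (-1) g ≠ ⊤) : HasFourierDensity (toField g) g := by
  have h := exists_hasFourierDensity hm hg
  rw [toField, dif_pos h]
  exact h.choose_spec

namespace IsMaximalFourierSolution

variable {ν t T : ℝ} {u₀ : Field3} {v : ℝ → Field3} {U₀ : R3 → C3} {V : ℝ → R3 → C3}

theorem conjReflect_ae_eq (h : IsMaximalFourierSolution ν U₀ V)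
    (h₀ : conjReflect U₀ =ᵐ[volume] U₀) (ht : 0 ≤ t)
    (htmax : ENNReal.ofReal t < fourierMaxTime ν U₀) : conjReflect (V t) =ᵐ[volume] V t := by
  have hconj := h.ae_eq ht ((h.isFourierSolution t htmax).conjReflect h₀)
  rw [h.eq_duhamelMap t ht htmax, conjReflect_duhamelMap, duhamelMap_congr hconj ⟨ht, le_rfl⟩]
  exact mild_congr_data h₀

theorem inner_eq_zero (h : IsMaximalFourierSolution ν U₀ V)
    (h₀ : ∀ᵐ ξ, inner ℂ (complexify ξ) (U₀ ξ) = 0) (ht : t ∈ Icc 0 T)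
    (hTmax : ENNReal.ofReal T < fourierMaxTime ν U₀) :
    ∀ᵐ ξ, inner ℂ (complexify ξ) (V t ξ) = 0 := by
  rw [h.eq_duhamelMap t ht.1 ((ENNReal.ofReal_le_ofReal ht.2).trans_lt hTmax)]
  filter_upwards [h₀, ae_integrableOn_of_lintegral_densityNorm
    (measurable_nonlinearHat h.measurable)
    (h.lintegral_densityNorm_nonlinearHat_ne_top hTmax)] with ξ h₀ξ hξ
  exact inner_mild_eq_zero hξ ht h₀ξ fun s => inner_leraySymbol ξ _

theorem hasFourierDensity (h : IsMaximalFourierSolution ν U₀ V) (ht : 0 ≤ t)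
    (htmax : ENNReal.ofReal t < fourierMaxTime ν U₀) :
    HasFourierDensity (toField (V t)) (V t) :=
  hasFourierDensity_toField h.measurable.of_uncurry_left.aestronglyMeasurable
    (h.densityNorm_ne_top ht htmax)

theorem hasFourierDensity_of_mem_Icc (h : IsMaximalFourierSolution ν U₀ V)
    (hTmax : ENNReal.ofReal T < fourierMaxTime ν U₀) (ht : t ∈ Icc 0 T) :
    HasFourierDensity (toField (V t)) (V t) :=
  h.hasFourierDensity ht.1 ((ENNReal.ofReal_le_ofReal ht.2).trans_lt hTmax)

theorem toField_initial (h : IsMaximalFourierSolution ν U₀ V) (h₀ : HasFourierDensity u₀ U₀) :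
    toField (V 0) = u₀ := by
  have hV := h.hasFourierDensity le_rfl (by simpa using h.pos)
  rw [h.initial] at hV ⊢
  exact hV.unique h₀

theorem memLpChi_toField_iff (h : IsMaximalFourierSolution ν U₀ V)
    (hTmax : ENNReal.ofReal T < fourierMaxTime ν U₀) {p : ℝ≥0∞} {s : ℤ} :
    MemLpChi p s T (fun t => toField (V t)) ↔
      eLpNorm (fun t => densityNorm s (V t)) p (volume.restrict (Ioc 0 T)) < ⊤ := by
  have hV : ∀ᵐ t ∂(volume.restrict (Icc 0 T)), HasFourierDensity (toField (V t)) (V t) :=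
    (ae_restrict_mem measurableSet_Icc).mono fun _ => h.hasFourierDensity_of_mem_Icc hTmax
  rw [MemLpChi, and_iff_right ⟨V, h.measurable.aestronglyMeasurable, hV⟩,
    eLpNorm_congr_ae (hV.mono fun t ht => ht.chiNorm_eq s), restrict_Ioc_eq_restrict_Icc]

theorem isSolution (h : IsMaximalFourierSolution ν U₀ V) (h₀ : HasFourierDensity u₀ U₀)
    (hdiv : IsDivFree u₀) (hTmax : ENNReal.ofReal T < fourierMaxTime ν U₀) :
    IsSolution ν u₀ T fun t => toField (V t) where
  memL2 := by
    rw [h.memLpChi_toField_iff hTmax, eLpNorm_densityNorm_zero_lt_top_iff]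
    exact (h.isFourierSolution T hTmax).sqL2Norm_ne_top
  divFree := by
    filter_upwards [ae_restrict_mem measurableSet_Icc] with t ht
    exact (h.hasFourierDensity_of_mem_Icc hTmax ht).isDivFree_iff.2
      (h.inner_eq_zero (h₀.isDivFree_iff.1 hdiv) ht hTmax)
  duhamel := by
    refine ⟨U₀, V, h₀, ⟨h.measurable.aestronglyMeasurable, ?_⟩, ?_⟩ <;>
      filter_upwards [ae_restrict_mem measurableSet_Icc] with t ht
    · exact h.hasFourierDensity_of_mem_Icc hTmax ht
    · exact .of_forall <| congrFun <|
        h.eq_duhamelMap t ht.1 ((ENNReal.ofReal_le_ofReal ht.2).trans_lt hTmax)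

theorem isRegular (h : IsMaximalFourierSolution ν U₀ V) (hT : 0 ≤ T)
    (hTmax : ENNReal.ofReal T < fourierMaxTime ν U₀) :
    IsRegular T fun t => toField (V t) where
  cont t ht := by
    have hVt := h.hasFourierDensity_of_mem_Icc hTmax ht
    refine ⟨?_, (h.tendsto_densityNorm_sub hTmax ht).congr' ?_⟩
    · rw [MemChi, hVt.chiNorm_eq]
      exact (h.densityNorm_ne_top ht.1
        ((ENNReal.ofReal_le_ofReal ht.2).trans_lt hTmax)).lt_top
    · filter_upwards [self_mem_nhdsWithin] with τ hτ
      exact (((h.hasFourierDensity_of_mem_Icc hTmax hτ).sub hVt).chiNorm_eq (-1)).symm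
  memL1 := by
    rw [h.memLpChi_toField_iff hTmax, eLpNorm_one_eq_lintegral_enorm]
    exact (h.lintegral_densityNorm_one_ne_top hT hTmax).lt_top
  memLinfty := by
    rw [h.memLpChi_toField_iff hTmax, eLpNorm_exponent_top]
    refine (essSup_le_of_ae_le _ ?_).trans_lt (ENNReal.add_ne_top.2
      ⟨h.data_ne_top, h.lintegral_densityNorm_nonlinearHat_ne_top hTmax⟩).lt_top
    filter_upwards [ae_restrict_mem measurableSet_Ioc] with t ht
    exact h.densityNorm_le (Ioc_subset_Icc_self ht) hTmax

theorem maxTime_eq (h : IsMaximalFourierSolution ν U₀ V) (h₀ : HasFourierDensity u₀ U₀)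
    (hdiv : IsDivFree u₀) : maxTime ν u₀ = fourierMaxTime ν U₀ := by
  have hiff (T : ℝ) : (0 < T ∧ ∃ u, IsSolution ν u₀ T u) ↔
      0 < T ∧ ∃ U, IsFourierSolution ν U₀ T U := by
    refine and_congr_right fun hT => ⟨fun ⟨u, hu⟩ => ?_, fun ⟨U, hU⟩ => ?_⟩
    · exact (hu.exists_isFourierSolution h₀).imp fun _ => And.left
    · exact ⟨_, h.isSolution h₀ hdiv (h.lt_fourierMaxTime hT.le hU)⟩
  simp only [maxTime, fourierMaxTime, hiff]

theorem ae_eq_toField (h : IsMaximalFourierSolution ν U₀ V) (h₀ : HasFourierDensity u₀ U₀)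
    (hT : 0 ≤ T) (hv : IsSolution ν u₀ T v) :
    ∀ᵐ t ∂(volume.restrict (Icc 0 T)), v t = toField (V t) := by
  obtain ⟨W, hW, hvW⟩ := hv.exists_isFourierSolution h₀
  have hTmax := h.lt_fourierMaxTime hT hW
  rw [← restrict_Ioc_eq_restrict_Icc]
  filter_upwards [hvW, h.ae_eq hT hW, ae_restrict_mem measurableSet_Ioc] with t hvt hWt ht
  exact (hvt.congr hWt).unique (h.hasFourierDensity_of_mem_Icc hTmax (Ioc_subset_Icc_self ht))

theorem isRealField_toField (h : IsMaximalFourierSolution ν U₀ V) (h₀ : HasFourierDensity u₀ U₀)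
    (hreal : IsRealField u₀) (ht : 0 ≤ t) (htmax : ENNReal.ofReal t < fourierMaxTime ν U₀) :
    IsRealField (toField (V t)) :=
  (h.hasFourierDensity ht htmax).isRealField_iff.2
    (h.conjReflect_ae_eq (h₀.isRealField_iff.1 hreal) ht htmax)

theorem small_data_chiNorm (h : IsMaximalFourierSolution ν U₀ V) (h₀ : HasFourierDensity u₀ U₀)
    (hsmall : chiNorm (-1) u₀ < ENNReal.ofReal ν) (hT : 0 ≤ T)
    (hTmax : ENNReal.ofReal T < fourierMaxTime ν U₀) :
    chiNorm (-1) (toField (V T)) + (ENNReal.ofReal ν - chiNorm (-1) u₀) *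
      ∫⁻ s in Icc 0 T, chiNorm 1 (toField (V s)) ≤ chiNorm (-1) u₀ := by
  rw [h₀.chiNorm_eq] at hsmall ⊢
  rw [(h.hasFourierDensity hT hTmax).chiNorm_eq, setLIntegral_congr_fun measurableSet_Icc
    fun s hs => (h.hasFourierDensity_of_mem_Icc hTmax hs).chiNorm_eq 1,
    ← restrict_Ioc_eq_restrict_Icc]
  exact h.small_data_energy hsmall hT hTmax

theorem lintegral_sq_chiNorm_eq_top (h : IsMaximalFourierSolution ν U₀ V)
    (hmax : fourierMaxTime ν U₀ ≠ ⊤) :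
    ∫⁻ t in Ico 0 (fourierMaxTime ν U₀).toReal, chiNorm 0 (toField (V t)) ^ 2 = ⊤ := by
  have hnorm : EqOn (fun t => chiNorm 0 (toField (V t)) ^ 2) (fun t => densityNorm 0 (V t) ^ 2)
      (Ico 0 (fourierMaxTime ν U₀).toReal) := fun t ht => by
    have htmax := (ENNReal.ofReal_lt_iff_lt_toReal ht.1 hmax).2 ht.2
    simp only [(h.hasFourierDensity ht.1 htmax).chiNorm_eq]
  rw [setLIntegral_congr_fun measurableSet_Ico hnorm, restrict_Ico_eq_restrict_Ioc]
  exact h.blowup hmax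

end IsMaximalFourierSolution

end ChiNS

end

theorem theorem1p2 (ν : ℝ) (hν : 0 < ν) (u₀ : ChiNS.Field3)
    (hu₀ : ChiNS.MemChi (-1) u₀) (hdiv : ChiNS.IsDivFree u₀) :
    -- local well-posedness
    (∃ T : ℝ, 0 < T ∧ ∃ u : ℝ → ChiNS.Field3,
      ChiNS.IsSolution ν u₀ T u ∧ ChiNS.IsRegular T u ∧ u 0 = u₀ ∧
      ∀ v, ChiNS.IsSolution ν u₀ T v → ∀ᵐ t ∂(volume.restrict (Icc 0 T)), v t = u t) ∧
    -- the maximal solution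
    ∃ u : ℝ → ChiNS.Field3,
      u 0 = u₀ ∧
      (∀ T : ℝ, 0 < T → ENNReal.ofReal T < ChiNS.maxTime ν u₀ →
        ChiNS.IsSolution ν u₀ T u ∧ ChiNS.IsRegular T u) ∧
      -- every solution on any interval coincides with it
      (∀ T : ℝ, 0 < T → ∀ v, ChiNS.IsSolution ν u₀ T v →
        ∀ᵐ t ∂(volume.restrict (Icc 0 T)), v t = u t) ∧
      -- real data give a real solution
      (ChiNS.IsRealField u₀ →
        ∀ t : ℝ, 0 ≤ t → ENNReal.ofReal t < ChiNS.maxTime ν u₀ → ChiNS.IsRealField (u t)) ∧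
      -- (i) global existence, with the a priori estimate
      (ChiNS.chiNorm (-1) u₀ < ENNReal.ofReal ν →
        ChiNS.maxTime ν u₀ = ⊤ ∧
        ∀ t : ℝ, 0 ≤ t →
          ChiNS.chiNorm (-1) (u t) +
            (ENNReal.ofReal ν - ChiNS.chiNorm (-1) u₀) *
              ∫⁻ s in Icc 0 t, ChiNS.chiNorm 1 (u s) ≤ ChiNS.chiNorm (-1) u₀) ∧
      -- (ii) blow-up criterion
      (ChiNS.maxTime ν u₀ ≠ ⊤ →
        ∫⁻ t in Ico 0 (ChiNS.maxTime ν u₀).toReal, ChiNS.chiNorm 0 (u t) ^ 2 = ⊤) := by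
  obtain ⟨U₀, hU₀, h₀, hfin⟩ := hu₀.exists_measurable_density
  obtain ⟨V, hV⟩ := ChiNS.exists_isMaximalFourierSolution hν hU₀ hfin
  obtain ⟨T, ⟨hT, U, hU⟩, -⟩ := ChiNS.lt_fourierMaxTime_iff.1 hV.pos
  have hTmax := hV.lt_fourierMaxTime hT.le hU
  rw [hV.maxTime_eq h₀ hdiv]
  refine ⟨⟨T, hT, fun t => ChiNS.toField (V t), hV.isSolution h₀ hdiv hTmax,
      hV.isRegular hT.le hTmax, hV.toField_initial h₀, fun v hv => hV.ae_eq_toField h₀ hT.le hv⟩,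
    fun t => ChiNS.toField (V t), hV.toField_initial h₀,
    fun S hS hSmax => ⟨hV.isSolution h₀ hdiv hSmax, hV.isRegular hS.le hSmax⟩,
    fun S hS v hv => hV.ae_eq_toField h₀ hS.le hv,
    fun hreal t ht htmax => hV.isRealField_toField h₀ hreal ht htmax, fun hsmall => ?_,
    hV.lintegral_sq_chiNorm_eq_top⟩
  have htop := hV.fourierMaxTime_eq_top_of_small_data (h₀.chiNorm_eq (-1) ▸ hsmall)
  exact ⟨htop, fun t ht =>
    hV.small_data_chiNorm h₀ hsmall ht (htop.symm ▸ ENNReal.ofReal_lt_top)⟩
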